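/- Let $n\ge 1$, let $\mathbb B_n=\{z\in\mathbb C^n:|z|<1\}$, let $H(\mathbb B_n)$ be the space of holomorphic functions in $\mathbb B_n$, let $dv$ be Lebesgue measure on $\mathbb B_n$, and let $dv_\alpha(z)=(1-|z|^2)^\alpha\,dv(z)$ for real $\alpha$. Let $Rf(z)=\sum_{j=1}^n z_j\,\partial f/\partial z_j(z)$ be the radial derivative, and $R^k$ its $k$-th iterate ($R^0f=f$). For $p>0$, real $\alpha$ and a nonnegative integer $k$ with $pk+\alpha>-1$, the generalized Bergman space $A^p_\alpha$ consists of all $f\in H(\mathbb B_n)$ such that $(1-|z|^2)^kR^kf(z)$ belongs to $L^p(\mathbb B_n,dv_\alpha)$, with the (quasi-)norm $$\|f\|_{p,\alpha}=|f(0)|+\Bigl(\int_{\mathbb B_n}\bigl|(1-|z|^2)^kR^kf(z)\bigr|^p\,dv_\alpha(z)\Bigr)^{1/p}.$$ The unweighted space $A^p=H(\mathbb B_n)\cap L^p(\mathbb B_n,dv)$ is the case $\alpha=0$, $k=0$, with norm $\|f\|_{p,0}$. For complex $s,t$ such that neither $n+s$ nor $n+s+t$ is a negative integer, and $f\in H(\mathbb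 B_n)$ with homogeneous expansion $f=\sum_{k\ge0}f_k$, let $$R_{s,t}f(z)=\sum_{k=0}^\infty\frac{\Gamma(n+1+s+t)\,\Gamma(n+1+k+s)}{\Gamma(n+1+s)\,\Gamma(n+1+k+s+t)}\,f_k(z).$$ **Theorem.** Let $p>0$, let $\alpha$ be real, let $k$ be any nonnegative integer with $pk+\alpha>-1$, used to define $A^p_\alpha$, and let $s$ be a complex number such that neither $n+s$ nor $n+s+\alpha/p$ is a negative integer. Then for every $f\in H(\mathbb B_n)$ the series defining $R_{s,\alpha/p}f$ converges absolutely at each point of $\mathbb B_n$ to a function in $H(\mathbb B_n)$, and $f\in A^p_\alpha$ if and only if $R_{s,\alpha/p}f\in A^p$. Moreover, $R_{s,\alpha/p}$ is linear on $H(\mathbb B_n)$ and maps $A^p_\alpha$ one-to-one onto $A^p$, and it is bounded with bounded inverse: there is a finite constant $C$, independent of $f$, such that for all $f\in A^p_\alpha$ $$\|R_{s,\alpha/p}f\|_{p,0}\le C\,\|f\|_{p,\alpha}\quad\text{and}\quad\|f\|_{p,\alpha}\le C\,\|R_{s,\alpha/p}f\|_{p,0}.$$ -/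

import Mathlib

open MeasureTheory Metric
open scoped ENNReal NNReal

noncomputable section

namespace BergmanBall

/-- `ℂⁿ` with its Euclidean norm `|z| = √(|z₁|² + ⋯ + |zₙ|²)`. -/
abbrev Cn (n : ℕ) : Type := EuclideanSpace ℂ (Fin n)

/-- The open unit ball of `ℂⁿ`. -/
abbrev unitBall (n : ℕ) : Set (Cn n) := ball (0 : Cn n) 1

/-- `f` is holomorphic in the unit ball. Functions in the ball are represented by functions on
`ℂⁿ`, of which only the values in the ball matter. -/
def Holo {n : ℕ} (f : Cn n → ℂ) : Prop := DifferentiableOn ℂ f (unitBall n)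

/-- The measure `dv_α = (1 - |z|²)^α dv` on the unit ball, where `dv` is Lebesgue measure. -/
def vMeasure (n : ℕ) (α : ℝ) : Measure (Cn n) :=
  (volume.restrict (unitBall n)).withDensity fun z => ENNReal.ofReal ((1 - ‖z‖ ^ 2) ^ α)

/-- The radial derivative `R f (z) = ∑ j, z_j ∂f/∂z_j (z)`. -/
def radialDeriv {n : ℕ} (f : Cn n → ℂ) (z : Cn n) : ℂ :=
  ∑ j : Fin n, z j * fderiv ℂ f z (EuclideanSpace.single j 1)

/-- The function `(1 - |z|²)^k R^k f(z)`, with `R^k` the `k`-fold iterate of `R`. -/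
def weightedDeriv {n : ℕ} (k : ℕ) (f : Cn n → ℂ) (z : Cn n) : ℂ :=
  (((1 - ‖z‖ ^ 2) ^ k : ℝ) : ℂ) * (radialDeriv^[k] f) z

/-- Membership in `A^p_α`, defined through a nonnegative integer `k` with `pk + α > -1`: `f` is
holomorphic in the ball and `(1 - |z|²)^k R^k f(z)` is in `L^p(dv_α)`.
For `α > -1` and `k = 0` this is `f ∈ H(𝔹ₙ) ∩ L^p(dv_α)`; in particular `α = 0`, `k = 0` gives
the unweighted space `A^p`. -/
def MemBergman {n : ℕ} (p α : ℝ) (k : ℕ) (f : Cn n → ℂ) : Prop :=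
  Holo f ∧ MemLp (weightedDeriv k f) (ENNReal.ofReal p) (vMeasure n α)

/-- The (quasi-)norm of `A^p_α` defined through `k`:
`|f(0)| + (∫ |(1 - |z|²)^k R^k f(z)|^p dv_α(z))^(1/p)`; it is finite on `A^p_α`. -/
def bergmanNorm {n : ℕ} (p α : ℝ) (k : ℕ) (f : Cn n → ℂ) : ℝ≥0∞ :=
  ‖f 0‖ₑ + eLpNorm (weightedDeriv k f) (ENNReal.ofReal p) (vMeasure n α)

/-- The component `f_k` of degree `k` in the homogeneous expansion `f = ∑ f_k` at the origin:
`f_k(z) = (1/k!) D^k f(0)(z, …, z) = ∑_{|m| = k} a_m z^m`. -/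
def homComponent {n : ℕ} (f : Cn n → ℂ) (k : ℕ) (z : Cn n) : ℂ :=
  (k.factorial : ℂ)⁻¹ * iteratedFDeriv ℂ k f 0 (fun _ => z)

/-- `Γ(n+1+s+t) Γ(n+1+k+s) / (Γ(n+1+s) Γ(n+1+k+s+t))`. -/
def fracCoeff (n : ℕ) (s t : ℂ) (k : ℕ) : ℂ :=
  (Complex.Gamma (n + 1 + s + t) * Complex.Gamma (n + 1 + k + s)) /
    (Complex.Gamma (n + 1 + s) * Complex.Gamma (n + 1 + k + s + t))

/-- The `k`-th term of the homogeneous expansion of `R_{s,t} f`. -/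
def fracIntTerm {n : ℕ} (s t : ℂ) (f : Cn n → ℂ) (z : Cn n) (k : ℕ) : ℂ :=
  fracCoeff n s t k * homComponent f k z

/-- The fractional radial integral operator `R_{s,t}`. -/
def fracInt {n : ℕ} (s t : ℂ) (f : Cn n → ℂ) (z : Cn n) : ℂ :=
  ∑' k : ℕ, fracIntTerm s t f z k

/-- `w` is not a negative integer. -/
def NotNegInt (w : ℂ) : Prop := ∀ m : ℤ, m < 0 → w ≠ m

end BergmanBall

end

/-! ### Holomorphic functions of several variables: Cauchy estimates, smoothness, slices. -/

section SeveralVariables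

variable {E : Type*} [NormedAddCommGroup E] [NormedSpace ℂ E]

/-! The operator `fracInt` multiplies the degree-`j` homogeneous component by a quotient of Gamma
functions that behaves like `j ^ (-t)`. Everything is therefore phrased for radial multipliers
`mulOp m`. If `m` grows subexponentially (`SubExp`), then `mulOp m` preserves holomorphy, and such
operators compose by multiplying their symbols. The coefficients `c j` of `fracInt` never vanish,
and both `c` and its reciprocal are subexponential, so convergence, linearity and invertibility on
holomorphic functions are formal.

The analytic content is `isMult_const_mul_gamma_ratio`: a symbol of order `-t` maps the Bergman
space with weight exponent `a` to the one with exponent `a - t * p`, provided both exponents exceed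
`-1`. Two kinds of symbols generate the rest. Linear factors `k + A` are first-order differential
operators and cost `p` in the exponent, by Cauchy estimates (`isMult_natCast_add`). Quotients `Γ(j +
B) / Γ(j + B + τ)` with `τ ≥ 1` are Beta integrals, that is, weighted averages of `g (x • z)` over
`x`, up to an exponentially small error (`isMult_gamma_ratio`). A quotient of arbitrary order is a
product of enough linear factors followed by a Gamma quotient with `τ ≥ 1`.

Duality and Minkowski's inequality fail for `p < 1`, so the estimates must not use them. Instead
`|g| ^ p` has the sub-mean value property for every `p > 0` (`enorm_rpow_mul_volume_le`). Hence the
values of `g` in a nontangential region with vertex `z` are all controlled by one integral of `|g| ^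
p` over a slightly larger region (`exists_pointwise_le_stolzInt`). Integrating that in `z` and
exchanging the integrals gives back a weighted integral of `|g| ^ p` over the ball
(`exists_lintegral_stolzInt_le`).

Finally `R^k` is the multiplier `j ^ k`, so the norm with parameters `α`, `k` is a weighted integral
with exponent `p * k + α`. Applying the multiplier theorem to `j ^ k / c j` gives one inequality,
and to `c j / j ^ k` the other. The lost constant term is supplied by `|f(0)|`. -/

theorem differentiableOn_slice {f : E → ℂ} {U : Set E} (hf : DifferentiableOn ℂ f U) (x v : E)
    {s : Set ℂ} (hs : ∀ c ∈ s, x + c • v ∈ U) :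
    DifferentiableOn ℂ (fun c : ℂ => f (x + c • v)) s :=
  hf.comp (t := U) (by fun_prop) hs

theorem hasDerivAt_slice {f : E → ℂ} {x v : E} {c : ℂ} (hf : DifferentiableAt ℂ f (x + c • v)) :
    HasDerivAt (fun c : ℂ => f (x + c • v)) (fderiv ℂ f (x + c • v) v) c := by
  have h : HasDerivAt (fun c : ℂ => x + c • v) v c := by
    simpa using ((hasDerivAt_id c).smul_const v).const_add x
  exact hf.hasFDerivAt.comp_hasDerivAt c h

theorem norm_fderiv_apply_le {f : E → ℂ} {x v : E} {δ M : ℝ} (hδ : 0 < δ)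
    (hf : ∀ c : ℂ, ‖c‖ ≤ δ → DifferentiableAt ℂ f (x + c • v))
    (hM : ∀ c : ℂ, ‖c‖ ≤ δ → ‖f (x + c • v)‖ ≤ M) : ‖fderiv ℂ f x v‖ ≤ M / δ := by
  have h0 : fderiv ℂ f x v = deriv (fun c : ℂ => f (x + c • v)) 0 := by
    have := hasDerivAt_slice (f := f) (x := x) (v := v) (c := 0) (hf 0 (by simpa using hδ.le))
    simp only [zero_smul, add_zero] at this
    exact this.deriv.symm
  rw [h0]
  apply Complex.norm_deriv_le_of_forall_mem_sphere_norm_le hδ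
  · apply DifferentiableOn.diffContOnCl
    intro c hc
    rw [closure_ball _ hδ.ne'] at hc
    exact (hasDerivAt_slice (hf c (by simpa using hc))).differentiableAt.differentiableWithinAt
  · intro c hc
    exact hM c (by simpa using (mem_sphere.1 hc).le)

theorem norm_fderiv_le_of_closedBall {f : E → ℂ} {U : Set E} (hU : IsOpen U)
    (hf : DifferentiableOn ℂ f U) {x : E} {δ M : ℝ} (hδ : 0 < δ) (hx : closedBall x δ ⊆ U)
    (hM : ∀ y ∈ closedBall x δ, ‖f y‖ ≤ M) : ‖fderiv ℂ f x‖ ≤ M / δ := by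
  have hM0 : 0 ≤ M := (norm_nonneg _).trans (hM x (by simpa using hδ.le))
  refine ContinuousLinearMap.opNorm_le_bound _ (by positivity) fun v => ?_
  rcases eq_or_ne v 0 with rfl | hv
  · simp
  have hv' : 0 < ‖v‖ := norm_pos_iff.2 hv
  have key : ∀ c : ℂ, ‖c‖ ≤ δ / ‖v‖ → x + c • v ∈ closedBall x δ := by
    intro c hc
    rw [le_div_iff₀ hv'] at hc
    simpa [dist_eq_norm, norm_smul] using hc
  have := norm_fderiv_apply_le (f := f) (x := x) (v := v) (M := M) (div_pos hδ hv')
    (fun c hc => hf.differentiableAt (hU.mem_nhds (hx (key c hc)))) fun c hc => hM _ (key c hc)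
  rwa [div_div_eq_mul_div, mul_div_right_comm] at this

/-- The directional derivative is a Cauchy integral over a circle in the complex line through `x` in
direction `v`. Its integrand depends holomorphically on `x`, so one may differentiate under the
integral. The Cauchy estimate for `fderiv` supplies the dominating constant. -/
theorem differentiableOn_fderiv_apply [FiniteDimensional ℂ E] {f : E → ℂ} {U : Set E}
    (hU : IsOpen U) (hf : DifferentiableOn ℂ f U) (v : E) :
    DifferentiableOn ℂ (fun x => fderiv ℂ f x v) U := by
  have : ProperSpace E := FiniteDimensional.proper ℂ E
  borelize E
  intro x₀ hx₀
  obtain ⟨R', hR', hRU'⟩ := nhds_basis_closedBall.mem_iff.1 (hU.mem_nhds hx₀)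
  -- Room for three moves of size `R`: the base point, the circle in direction `v`, and the ball
  -- used in the Cauchy estimate.
  obtain ⟨R, hR, hRU⟩ : ∃ R > 0, closedBall x₀ (3 * R) ⊆ U :=
    ⟨R' / 3, by positivity, by rwa [mul_div_cancel₀ _ (three_ne_zero)]⟩
  set r : ℝ := R / (‖v‖ + 1) with hr
  have hv1 : 0 < ‖v‖ + 1 := by positivity
  have hr0 : 0 < r := by positivity
  have hrv : r * ‖v‖ ≤ R := by
    rw [hr, div_mul_eq_mul_div, div_le_iff₀ hv1]; nlinarith
  obtain ⟨M, hM⟩ := (isCompact_closedBall x₀ (3 * R)).exists_bound_of_continuousOn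
    (hf.continuousOn.mono hRU)
  have hmem : ∀ x ∈ ball x₀ R, ∀ c : ℂ, ‖c‖ ≤ r → x + c • v ∈ closedBall x₀ (2 * R) := by
    intro x hx c hc
    rw [mem_closedBall, dist_eq_norm, add_sub_right_comm]
    have h1 : ‖x - x₀‖ < R := by simpa [dist_eq_norm] using hx
    have h2 : ‖c • v‖ ≤ R := by
      rw [norm_smul]; exact (mul_le_mul_of_nonneg_right hc (norm_nonneg _)).trans hrv
    linarith [norm_add_le (x - x₀) (c • v)]
  have hsub : closedBall x₀ (2 * R) ⊆ U :=
    (closedBall_subset_closedBall (by linarith)).trans hRU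
  have hdiff : ∀ y ∈ closedBall x₀ (2 * R), DifferentiableAt ℂ f y := fun y hy =>
    hf.differentiableAt (hU.mem_nhds (hsub hy))
  have hfd : ∀ y ∈ closedBall x₀ (2 * R), ‖fderiv ℂ f y‖ ≤ M / R := by
    intro y hy
    have hss : closedBall y R ⊆ closedBall x₀ (3 * R) :=
      closedBall_subset_closedBall' (by have := mem_closedBall.1 hy; linarith)
    exact norm_fderiv_le_of_closedBall hU hf hR (hss.trans hRU) fun z hz => hM z (hss hz)
  have hcm : ∀ θ : ℝ, ‖circleMap 0 r θ‖ = r := fun θ => by simp [hr0.le]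
  let a : ℝ → ℂ := fun θ => deriv (circleMap 0 r) θ * (1 / (circleMap 0 r θ - 0) ^ 2)
  have ha : Continuous a := by
    have h0 : ∀ θ, (circleMap 0 r θ - 0) ^ 2 ≠ 0 := fun θ => by
      simp [hr0.ne']
    simp only [a, deriv_circleMap]
    exact ((continuous_circleMap 0 r).mul continuous_const).mul
      (continuous_const.div (by fun_prop) h0)
  have ha' : ∀ θ, ‖a θ‖ = r⁻¹ := fun θ => by
    simp only [a, deriv_circleMap, norm_mul, norm_div, norm_pow, sub_zero, hcm, Complex.norm_I,
      norm_one]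
    field_simp
  let F : E → ℝ → ℂ := fun x θ => a θ * f (x + circleMap 0 r θ • v)
  let F' : E → ℝ → E →L[ℂ] ℂ := fun x θ => a θ • fderiv ℂ f (x + circleMap 0 r θ • v)
  have hFcont : ∀ x ∈ ball x₀ R, Continuous (F x) := by
    intro x hx
    refine ha.mul ?_
    refine hf.continuousOn.comp_continuous (by fun_prop) fun θ => hsub (hmem x hx _ (hcm θ).le)
  have hx₀R : x₀ ∈ ball x₀ R := mem_ball_self hR
  have main : HasFDerivAt (fun x => ∫ θ in (0 : ℝ)..2 * Real.pi, F x θ)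
      (∫ θ in (0 : ℝ)..2 * Real.pi, F' x₀ θ) x₀ := by
    refine intervalIntegral.hasFDerivAt_integral_of_dominated_of_fderiv_le
      (bound := fun _ => r⁻¹ * (M / R)) (ball_mem_nhds x₀ hR) ?_ ?_ ?_ ?_ ?_ ?_
    · filter_upwards [ball_mem_nhds x₀ hR] with x hx
      exact (hFcont x hx).aestronglyMeasurable
    · exact (hFcont x₀ hx₀R).intervalIntegrable _ _
    · refine Measurable.aestronglyMeasurable ?_
      refine ha.measurable.smul ((measurable_fderiv ℂ f).comp ?_)
      exact (by fun_prop : Continuous fun θ => x₀ + circleMap 0 r θ • v).measurable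
    · refine Filter.Eventually.of_forall fun θ _ x hx => ?_
      rw [norm_smul, ha']
      gcongr
      exact hfd _ (hmem x hx _ (hcm θ).le)
    · exact intervalIntegrable_const
    · refine Filter.Eventually.of_forall fun θ _ x hx => ?_
      have h1 := (hdiff _ (hmem x hx _ (hcm θ).le)).hasFDerivAt
      have h2 : HasFDerivAt (fun x => f (x + circleMap 0 r θ • v))
          (fderiv ℂ f (x + circleMap 0 r θ • v)) x := by
        exact h1.comp x ((hasFDerivAt_id x).add_const (circleMap 0 r θ • v))
      exact h2.const_mul (a θ)
  refine DifferentiableAt.differentiableWithinAt ?_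
  refine ((main.differentiableAt.const_mul (2 * ↑Real.pi * Complex.I)⁻¹)).congr_of_eventuallyEq ?_
  filter_upwards [ball_mem_nhds x₀ hR] with x hx
  have hd := DifferentiableOn.deriv_eq_smul_circleIntegral (f := fun c : ℂ => f (x + c • v))
    (c := 0) hr0 (differentiableOn_slice hf x v fun c hc => hsub (hmem x hx c (by simpa using hc)))
  have h0 : fderiv ℂ f x v = deriv (fun c : ℂ => f (x + c • v)) 0 := by
    have := hasDerivAt_slice (f := f) (x := x) (v := v) (c := 0)
      (hdiff _ (hmem x hx 0 (by simpa using hr0.le)))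
    simp only [zero_smul, add_zero] at this
    exact this.deriv.symm
  rw [h0, eq_inv_mul_iff_mul_eq₀ Complex.two_pi_I_ne_zero, ← smul_eq_mul, ← hd,
    circleIntegral]
  refine intervalIntegral.integral_congr fun θ _ => ?_
  simp only [F, a, smul_eq_mul, mul_assoc]

theorem contDiffOn_of_differentiableOn_complex [FiniteDimensional ℂ E] {f : E → ℂ} {U : Set E}
    (hU : IsOpen U) (hf : DifferentiableOn ℂ f U) (k : ℕ) : ContDiffOn ℂ k f U := by
  induction k generalizing f with
  | zero => exact contDiffOn_zero.2 hf.continuousOn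
  | succ k ih =>
    push_cast
    refine contDiffOn_succ_of_fderiv_apply hf (by simp) fun y => ?_
    refine (ih (differentiableOn_fderiv_apply hU hf y)).congr fun x hx => ?_
    rw [fderivWithin_of_isOpen hU hx]

/-- The chain rule for the linear map `c ↦ c • z`. It reduces facts about homogeneous components to
one-variable Taylor series on slices. -/
theorem iteratedFDeriv_apply_eq_iteratedDeriv_slice [FiniteDimensional ℂ E] {f : E → ℂ}
    {U : Set E} (hU : IsOpen U) (h0 : (0 : E) ∈ U) (hf : DifferentiableOn ℂ f U) (k : ℕ) (z : E) :
    iteratedFDeriv ℂ k f 0 (fun _ => z) = iteratedDeriv k (fun c : ℂ => f (c • z)) 0 := by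
  let g : ℂ →L[ℂ] E := ContinuousLinearMap.toSpanSingleton ℂ z
  have hg : IsOpen (g ⁻¹' U) := hU.preimage g.continuous
  have h0' : (0 : ℂ) ∈ g ⁻¹' U := by simpa using h0
  have h := ContinuousLinearMap.iteratedFDerivWithin_comp_right g
    (contDiffOn_of_differentiableOn_complex hU hf k) hU.uniqueDiffOn hg.uniqueDiffOn
    (x := 0) (by simpa using h0) (i := k) le_rfl
  rw [iteratedFDerivWithin_of_isOpen k hg h0', map_zero,
    iteratedFDerivWithin_of_isOpen k hU h0] at h
  have : (f ∘ g) = fun c : ℂ => f (c • z) := by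
    ext c; simp [g]
  rw [iteratedDeriv_eq_iteratedFDeriv, ← this, h]
  simp [g]

end SeveralVariables

/-! ### Homogeneous expansions and radial multipliers. -/

namespace BergmanBall

section Multipliers

variable {n : ℕ}

theorem Holo.differentiableAt {f : Cn n → ℂ} (hf : Holo f) {z : Cn n} (hz : ‖z‖ < 1) :
    DifferentiableAt ℂ f z :=
  DifferentiableOn.differentiableAt hf (isOpen_ball.mem_nhds (by simpa using hz))

theorem Holo.exists_bound {f : Cn n → ℂ} (hf : Holo f) {r : ℝ} (hr : r < 1) :
    ∃ M, 0 ≤ M ∧ ∀ w, ‖w‖ ≤ r → ‖f w‖ ≤ M := by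
  obtain ⟨M, hM⟩ := (isCompact_closedBall (0 : Cn n) r).exists_bound_of_continuousOn
    (DifferentiableOn.continuousOn (f := f) (hf.mono (closedBall_subset_ball hr)))
  exact ⟨max M 0, le_max_right _ _, fun w hw => (hM w (by simpa using hw)).trans (le_max_left _ _)⟩

theorem Holo.differentiableOn_slice {f : Cn n → ℂ} (hf : Holo f) {z : Cn n} {R : ℝ}
    (hR : R * ‖z‖ ≤ 1) : DifferentiableOn ℂ (fun c : ℂ => f (c • z)) (ball 0 R) := by
  have h := _root_.differentiableOn_slice (s := ball 0 R) hf (0 : Cn n) z ?_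
  · simpa only [zero_add] using h
  · intro c hc
    rw [mem_ball_zero_iff] at hc
    simp only [zero_add, mem_ball_zero_iff, norm_smul]
    rcases (norm_nonneg z).eq_or_lt with h0 | h0
    · rw [← h0, mul_zero]; exact one_pos
    · exact (mul_lt_mul_of_pos_right hc h0).trans_le hR

theorem homComponent_eq {f : Cn n → ℂ} (hf : Holo f) (k : ℕ) (z : Cn n) :
    homComponent f k z = (k.factorial : ℂ)⁻¹ * iteratedDeriv k (fun c : ℂ => f (c • z)) 0 := by
  rw [homComponent, iteratedFDeriv_apply_eq_iteratedDeriv_slice isOpen_ball (by simp) hf]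

theorem homComponent_smul (f : Cn n → ℂ) (k : ℕ) (c : ℂ) (z : Cn n) :
    homComponent f k (c • z) = c ^ k * homComponent f k z := by
  rw [homComponent, homComponent, ContinuousMultilinearMap.map_smul_univ]
  simp only [Finset.prod_const, Finset.card_univ, Fintype.card_fin, smul_eq_mul]
  ring

theorem homComponent_zero_eq (f : Cn n → ℂ) (z : Cn n) : homComponent f 0 z = f 0 := by
  simp [homComponent]

theorem homComponent_congr {f g : Cn n → ℂ} (h : Set.EqOn f g (unitBall n)) (k : ℕ) :
    homComponent f k = homComponent g k := by
  have h' : f =ᶠ[nhds 0] g := h.eventuallyEq_of_mem (ball_mem_nhds _ one_pos)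
  ext z
  rw [homComponent, homComponent, (h'.iteratedFDeriv ℂ k).eq_of_nhds]

theorem differentiable_homComponent (f : Cn n → ℂ) (k : ℕ) :
    Differentiable ℂ (homComponent f k) := by
  have h1 : ContDiff ℂ 1 fun m : Fin k → Cn n => iteratedFDeriv ℂ k f 0 m :=
    (iteratedFDeriv ℂ k f 0).contDiff
  have h2 : Differentiable ℂ fun z : Cn n => (fun _ : Fin k => z) := by fun_prop
  exact ((h1.differentiable (by simp)).comp h2).const_mul _

theorem hasSum_homComponent_smul {f : Cn n → ℂ} (hf : Holo f) {z : Cn n} {R : ℝ}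
    (hR : R * ‖z‖ ≤ 1) {c : ℂ} (hc : ‖c‖ < R) :
    HasSum (fun k => homComponent f k z * c ^ k) (f (c • z)) := by
  have h := Complex.hasSum_taylorSeries_on_ball (hf.differentiableOn_slice hR)
    (z := c) (by simpa using hc)
  refine h.congr_fun fun k => ?_
  rw [homComponent_eq hf]
  simp only [sub_zero, smul_eq_mul]
  ring

theorem exists_slice_radius {z : Cn n} (hz : ‖z‖ < 1) : ∃ R : ℝ, 1 < R ∧ R * ‖z‖ ≤ 1 := by
  have h0 : 0 < 1 + ‖z‖ := by positivity
  refine ⟨2 / (1 + ‖z‖), ?_, ?_⟩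
  · rw [lt_div_iff₀ h0]; linarith
  · rw [div_mul_eq_mul_div, div_le_iff₀ h0]; linarith

theorem hasSum_homComponent {f : Cn n → ℂ} (hf : Holo f) {z : Cn n} (hz : ‖z‖ < 1) :
    HasSum (fun k => homComponent f k z) (f z) := by
  obtain ⟨R, hR1, hR⟩ := exists_slice_radius hz
  simpa using hasSum_homComponent_smul hf hR (c := 1) (by simpa using hR1)

/-- One-variable Cauchy estimates on slices bound the component on the ball of radius `r`;
homogeneity extends the bound to every `z`. -/
theorem norm_homComponent_le {f : Cn n → ℂ} (hf : Holo f) {r M : ℝ} (hr0 : 0 < r) (hr : r < 1)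
    (hM : ∀ w, ‖w‖ ≤ r → ‖f w‖ ≤ M) (k : ℕ) (z : Cn n) :
    ‖homComponent f k z‖ ≤ M * (‖z‖ / r) ^ k := by
  have key : ∀ w : Cn n, ‖w‖ ≤ r → ‖homComponent f k w‖ ≤ M := by
    intro w hw
    have hR : r⁻¹ * ‖w‖ ≤ 1 := by rw [inv_mul_le_iff₀ hr0]; simpa using hw
    have hsub : closedBall (0 : ℂ) 1 ⊆ ball 0 r⁻¹ := closedBall_subset_ball (one_lt_inv₀ hr0 |>.2 hr)
    have h := Complex.norm_iteratedDeriv_le_of_forall_mem_sphere_norm_le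
      (f := fun c : ℂ => f (c • w)) (c := 0) (R := 1) (C := M) k one_pos
      (((hf.differentiableOn_slice hR).mono
        ((closure_ball (0 : ℂ) one_ne_zero).trans_subset hsub)).diffContOnCl) (by
        intro c hc
        refine hM _ ?_
        have : ‖c‖ = 1 := by simpa using hc
        rwa [norm_smul, this, one_mul])
    rw [homComponent_eq hf, norm_mul, norm_inv, Complex.norm_natCast,
      inv_mul_le_iff₀ (by positivity)]
    simpa using h
  rcases eq_or_ne z 0 with rfl | hz
  · rcases k with _ | k
    · simpa using key 0 (by simpa using hr0.le)
    · have := homComponent_smul f (k + 1) 0 (0 : Cn n)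
      simp only [smul_zero] at this
      rw [this]; simp
  · have hz' : 0 < ‖z‖ := norm_pos_iff.2 hz
    have h1 : z = ((‖z‖ / r : ℝ) : ℂ) • (((r / ‖z‖ : ℝ) : ℂ) • z) := by
      rw [smul_smul, ← Complex.ofReal_mul, div_mul_div_cancel₀ hr0.ne', div_self hz'.ne']
      simp
    have h2 : ‖((r / ‖z‖ : ℝ) : ℂ) • z‖ ≤ r := by
      rw [norm_smul, Complex.norm_real, Real.norm_of_nonneg (by positivity),
        div_mul_cancel₀ _ hz'.ne']
    rw [h1, homComponent_smul, ← h1, norm_mul, norm_pow, Complex.norm_real,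
      Real.norm_of_nonneg (by positivity), mul_comm]
    gcongr
    exact key _ h2

/-- A sequence `m` of subexponential growth: `‖m k‖ r ^ k` is bounded for every `r < 1`. -/
def SubExp (m : ℕ → ℂ) : Prop := ∀ r : ℝ, 0 < r → r < 1 → ∃ C, ∀ k, ‖m k‖ * r ^ k ≤ C

theorem SubExp.mul {m m' : ℕ → ℂ} (h : SubExp m) (h' : SubExp m') :
    SubExp fun k => m k * m' k := by
  intro r h0 h1
  -- Splitting `r ^ k` as `√r ^ k * √r ^ k` gives each factor its own geometric decay.
  have hs0 := Real.sqrt_pos.2 h0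
  have hs1 : Real.sqrt r < 1 := by rw [Real.sqrt_lt' one_pos]; simpa using h1
  obtain ⟨C, hC⟩ := h _ hs0 hs1
  obtain ⟨C', hC'⟩ := h' _ hs0 hs1
  refine ⟨C * C', fun k => ?_⟩
  have : ‖m k * m' k‖ * r ^ k =
      (‖m k‖ * Real.sqrt r ^ k) * (‖m' k‖ * Real.sqrt r ^ k) := by
    rw [norm_mul, ← Real.mul_self_sqrt h0.le, mul_pow, Real.sqrt_mul_self hs0.le]; ring
  rw [this]
  exact mul_le_mul (hC k) (hC' k) (by positivity) ((by positivity : (0:ℝ) ≤ _).trans (hC k))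

theorem SubExp.of_bounded {m : ℕ → ℂ} {C : ℝ} (h : ∀ k, ‖m k‖ ≤ C) : SubExp m :=
  fun r h0 h1 => ⟨C, fun k => by
    have := mul_le_mul (h k) (pow_le_one₀ (n := k) h0.le h1.le) (by positivity)
      ((norm_nonneg _).trans (h k))
    simpa using this⟩

theorem SubExp.summable {m : ℕ → ℂ} (h : SubExp m) {r : ℝ} (h0 : 0 ≤ r) (h1 : r < 1) :
    Summable fun k => ‖m k‖ * r ^ k := by
  set s := (1 + r) / 2
  have hs0 : 0 < s := by simp only [s]; linarith
  have hs1 : s < 1 := by simp only [s]; linarith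
  have hrs : r < s := by simp only [s]; linarith
  obtain ⟨C, hC⟩ := h s hs0 hs1
  refine Summable.of_nonneg_of_le (fun k => by positivity) (fun k => ?_)
    ((summable_geometric_of_lt_one (div_nonneg h0 hs0.le) ((div_lt_one hs0).2 hrs)).mul_left C)
  have : ‖m k‖ * r ^ k = (‖m k‖ * s ^ k) * (r / s) ^ k := by
    rw [mul_assoc, ← mul_pow, mul_div_cancel₀ _ hs0.ne']
  rw [this]
  gcongr
  exact hC k

theorem SubExp.of_summable {m : ℕ → ℂ}
    (h : ∀ r : ℝ, 0 < r → r < 1 → Summable fun k => ‖m k‖ * r ^ k) : SubExp m := by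
  intro r h0 h1
  exact ⟨∑' k, ‖m k‖ * r ^ k, fun k => (h r h0 h1).le_tsum k fun _ _ => by positivity⟩

theorem SubExp.of_ratio {m : ℕ → ℂ} (h0 : ∀ᶠ k in Filter.atTop, m k ≠ 0)
    (h : Filter.Tendsto (fun k => m (k + 1) / m k) Filter.atTop (nhds 1)) : SubExp m := by
  refine SubExp.of_summable fun r hr0 hr1 => ?_
  refine summable_of_ratio_test_tendsto_lt_one hr1 ?_ (?_ : Filter.Tendsto _ _ (nhds r))
  · filter_upwards [h0] with k hk
    positivity
  · have h2 : Filter.Tendsto (fun k => ‖m (k + 1) / m k‖ * r) Filter.atTop (nhds (‖(1:ℂ)‖ * r)) :=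
      h.norm.mul_const r
    rw [norm_one, one_mul] at h2
    refine h2.congr' ?_
    filter_upwards [h0] with k hk
    have := norm_pos_iff.2 hk
    rw [norm_mul, norm_mul, norm_norm, norm_norm, norm_pow, norm_pow, Real.norm_of_nonneg hr0.le,
      norm_div, pow_succ]
    field_simp

theorem subExp_natCast : SubExp fun k => (k : ℂ) := by
  refine SubExp.of_summable fun r h0 h1 => ?_
  have := summable_pow_mul_geometric_of_norm_lt_one (r := r) 1
    (by rwa [Real.norm_of_nonneg h0.le])
  simpa using this

theorem SubExp.add {m m' : ℕ → ℂ} (h : SubExp m) (h' : SubExp m') :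
    SubExp fun k => m k + m' k := by
  intro r h0 h1
  obtain ⟨C, hC⟩ := h r h0 h1
  obtain ⟨C', hC'⟩ := h' r h0 h1
  refine ⟨C + C', fun k => ?_⟩
  have := mul_le_mul_of_nonneg_right (norm_add_le (m k) (m' k)) (pow_nonneg h0.le k)
  linarith [hC k, hC' k, add_mul ‖m k‖ ‖m' k‖ (r ^ k)]

theorem subExp_const (a : ℂ) : SubExp fun _ => a := SubExp.of_bounded (C := ‖a‖) fun _ => le_rfl

theorem SubExp.pow {m : ℕ → ℂ} (h : SubExp m) (j : ℕ) : SubExp fun k => m k ^ j := by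
  induction j with
  | zero => simpa using subExp_const 1
  | succ j ih => simpa only [pow_succ] using ih.mul h

/-- The radial multiplier operator `∑ f_k ↦ ∑ m_k f_k`. -/
noncomputable def mulOp (m : ℕ → ℂ) (f : Cn n → ℂ) (z : Cn n) : ℂ := ∑' k, m k * homComponent f k z

theorem fracInt_eq_mulOp (s t : ℂ) (f : Cn n → ℂ) :
    fracInt s t f = mulOp (fracCoeff n s t) f := rfl

theorem exists_homComponent_bound {f : Cn n → ℂ} (hf : Holo f) {m : ℕ → ℂ} (hm : SubExp m) {r : ℝ}
    (hr0 : 0 ≤ r) (hr : r < 1) : ∃ u : ℕ → ℝ, Summable u ∧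
      ∀ k (z : Cn n), ‖z‖ ≤ r → ‖m k * homComponent f k z‖ ≤ u k := by
  set s := (1 + r) / 2
  have hs0 : 0 < s := by simp only [s]; linarith
  have hs1 : s < 1 := by simp only [s]; linarith
  have hrs : r < s := by simp only [s]; linarith
  obtain ⟨M, hM0, hM⟩ := hf.exists_bound hs1
  refine ⟨fun k => M * (‖m k‖ * (r / s) ^ k), (hm.summable (div_nonneg hr0 hs0.le)
    ((div_lt_one hs0).2 hrs)).mul_left M, fun k z hz => ?_⟩
  rw [norm_mul]
  simp only [mul_left_comm M]
  gcongr
  refine (norm_homComponent_le hf hs0 hs1 hM k z).trans ?_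
  gcongr

theorem summable_mulOp {f : Cn n → ℂ} (hf : Holo f) {m : ℕ → ℂ} (hm : SubExp m) {z : Cn n}
    (hz : ‖z‖ < 1) : Summable fun k => m k * homComponent f k z := by
  obtain ⟨u, hu, h⟩ := exists_homComponent_bound hf hm (norm_nonneg z) hz
  exact Summable.of_norm_bounded hu fun k => h k z le_rfl

/-- The series may be differentiated term by term on a smaller ball: Cauchy estimates turn the
summable majorant on radius `r'` into one for the derivatives on radius `r`. -/
theorem holo_mulOp {f : Cn n → ℂ} (hf : Holo f) {m : ℕ → ℂ} (hm : SubExp m) :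
    Holo (mulOp m f) := by
  intro z hz
  rw [mem_ball_zero_iff] at hz
  set r := (1 + ‖z‖) / 2
  have hzr : ‖z‖ < r := by simp only [r]; linarith
  have hr1 : r < 1 := by simp only [r]; linarith
  set r' := (1 + r) / 2
  have hrr' : r < r' := by simp only [r']; linarith
  have hr'1 : r' < 1 := by simp only [r']; linarith
  have hr0 : 0 < r := (norm_nonneg z).trans_lt hzr
  obtain ⟨u, hu, h⟩ := exists_homComponent_bound hf hm (hr0.trans hrr').le hr'1
  have hδ : 0 < r' - r := sub_pos.2 hrr'
  have hd : ∀ k, Differentiable ℂ fun z : Cn n => m k * homComponent f k z :=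
    fun k => (differentiable_homComponent f k).const_mul _
  have := hasFDerivAt_tsum_of_isPreconnected (𝕜 := ℂ) (u := fun k => u k / (r' - r))
    (f := fun k (z : Cn n) => m k * homComponent f k z)
    (f' := fun k => fderiv ℂ fun z : Cn n => m k * homComponent f k z)
    (s := ball 0 r) (x₀ := 0) (x := z) (hu.div_const _) isOpen_ball
    (convex_ball _ _).isPreconnected (fun k x _ => (hd k x).hasFDerivAt)
    (fun k x hx => norm_fderiv_le_of_closedBall isOpen_univ (hd k).differentiableOn hδ
      (Set.subset_univ _) fun y hy => h k y ?_) (mem_ball_self hr0)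
    (summable_mulOp hf hm (by simp)) (by simpa using hzr)
  · exact this.differentiableAt.differentiableWithinAt
  · rw [mem_ball_zero_iff] at hx
    rw [mem_closedBall_iff_norm] at hy
    have := norm_add_le (y - x) x
    rw [sub_add_cancel] at this
    linarith

/-- Power series coefficients in one variable are unique, so any expansion along the slice through
`z` identifies the components. In particular it lets one read off the components of `mulOp m f`. -/
theorem homComponent_unique {g : Cn n → ℂ} (hg : Holo g) {z : Cn n} {q : ℕ → ℂ} {r : ℝ}
    (hr : 0 < r) (h : ∀ c : ℂ, ‖c‖ < r → HasSum (fun k => q k * c ^ k) (g (c • z))) (k : ℕ) :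
    homComponent g k z = q k := by
  obtain ⟨s, hs0, hsr⟩ : ∃ s : ℝ≥0, 0 < s ∧ (s : ℝ) < r :=
    ⟨(r / 2).toNNReal, by simpa using hr, by rw [Real.coe_toNNReal _ (by positivity)]; linarith⟩
  have hp : HasFPowerSeriesOnBall (fun c : ℂ => g (c • z)) (FormalMultilinearSeries.ofScalars ℂ q)
      0 s := by
    refine ⟨?_, by exact_mod_cast hs0, fun {y} hy => ?_⟩
    · refine FormalMultilinearSeries.le_radius_of_tendsto _ (l := 0) ?_
      have h1 := (h (s : ℝ) (by simpa using hsr)).summable.tendsto_atTop_zero.norm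
      simpa using h1
    · have hy' : ‖y‖ < r := by
        have : ‖y‖ < s := by simpa [edist_zero_right, enorm] using hy
        exact this.trans hsr
      simpa [FormalMultilinearSeries.ofScalars, mul_comm] using h y hy'
  have h2 := hp.factorial_smul (1 : ℂ) k
  rw [homComponent_eq hg, iteratedDeriv_eq_iteratedFDeriv, ← h2]
  have : (k.factorial : ℂ) ≠ 0 := by exact_mod_cast k.factorial_ne_zero
  simp [FormalMultilinearSeries.ofScalars, nsmul_eq_mul]
  field_simp

theorem homComponent_mulOp {f : Cn n → ℂ} (hf : Holo f) {m : ℕ → ℂ} (hm : SubExp m) (k : ℕ)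
    (z : Cn n) : homComponent (mulOp m f) k z = m k * homComponent f k z := by
  have hz : 0 < 1 + ‖z‖ := by positivity
  refine homComponent_unique (q := fun k => m k * homComponent f k z) (holo_mulOp hf hm)
    (inv_pos.2 hz) (fun c hc => ?_) k
  have h1 : ‖c • z‖ < 1 := by
    rw [norm_smul]
    refine (mul_le_mul_of_nonneg_right hc.le (norm_nonneg z)).trans_lt ?_
    rw [inv_mul_lt_iff₀ hz]
    linarith
  refine (summable_mulOp hf hm h1).hasSum.congr_fun fun j => ?_
  rw [homComponent_smul]
  ring

theorem mulOp_mulOp {f : Cn n → ℂ} (hf : Holo f) {m m' : ℕ → ℂ} (hm' : SubExp m') :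
    mulOp m (mulOp m' f) = mulOp (fun k => m k * m' k) f := by
  ext z
  simp only [mulOp, mul_assoc]
  refine tsum_congr fun k => ?_
  rw [← homComponent_mulOp hf hm']

theorem mulOp_congr {f g : Cn n → ℂ} (h : Set.EqOn f g (unitBall n)) (m : ℕ → ℂ) :
    mulOp m f = mulOp m g := by
  ext z
  simp only [mulOp, homComponent_congr h]

theorem mulOp_one {f : Cn n → ℂ} (hf : Holo f) {z : Cn n} (hz : ‖z‖ < 1) :
    mulOp (fun _ => 1) f z = f z := by
  simpa [mulOp] using (hasSum_homComponent hf hz).tsum_eq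

theorem radialDeriv_eq_fderiv (f : Cn n → ℂ) (z : Cn n) :
    radialDeriv f z = fderiv ℂ f z z := by
  rw [radialDeriv]
  conv_rhs => enter [2]; rw [← (EuclideanSpace.basisFun (Fin n) ℂ).sum_repr z]
  simp [map_sum]

theorem Holo.radialDeriv {f : Cn n → ℂ} (hf : Holo f) : Holo (radialDeriv f) := by
  unfold Holo BergmanBall.radialDeriv
  refine DifferentiableOn.fun_sum fun j _ => ?_
  exact DifferentiableOn.mul (by fun_prop) (differentiableOn_fderiv_apply isOpen_ball hf _)

/-- The radial derivative at `z` is the derivative of `c ↦ f (c • z)` at `c = 1`. Its Taylor series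
there is the termwise derivative of the slice expansion, which converges because the slice extends
past the unit disc. -/
theorem radialDeriv_eq_mulOp {f : Cn n → ℂ} (hf : Holo f) {z : Cn n} (hz : ‖z‖ < 1) :
    BergmanBall.radialDeriv f z = mulOp (fun k => (k : ℂ)) f z := by
  obtain ⟨R, hR1, hR⟩ := exists_slice_radius hz
  have h1 : (1 : ℂ) ∈ ball (0 : ℂ) R := by simpa using hR1
  have hφ := hf.differentiableOn_slice hR
  have hs := Complex.hasSum_taylorSeries_on_ball (hφ.deriv isOpen_ball) h1
  have hd : deriv (fun c : ℂ => f (c • z)) 1 = BergmanBall.radialDeriv f z := by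
    rw [radialDeriv_eq_fderiv]
    have := hasDerivAt_slice (f := f) (x := 0) (v := z) (c := 1)
      (by simpa using hf.differentiableAt hz)
    simpa using this.deriv
  rw [hd] at hs
  have h2 : HasSum (fun k => ((k + 1 : ℕ) : ℂ) * homComponent f (k + 1) z)
      (BergmanBall.radialDeriv f z) := by
    refine hs.congr_fun fun k => ?_
    rw [homComponent_eq hf, ← iteratedDeriv_succ']
    have h3 : (k.factorial : ℂ) ≠ 0 := by exact_mod_cast k.factorial_ne_zero
    have h4 : ((k : ℂ) + 1) ≠ 0 := by exact_mod_cast k.succ_ne_zero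
    simp only [sub_zero, one_pow, smul_eq_mul, Nat.factorial_succ]
    push_cast
    field_simp
  rw [hasSum_nat_add_iff (f := fun k => (k : ℂ) * homComponent f k z) 1] at h2
  simpa [mulOp] using h2.tsum_eq.symm

theorem iterate_radialDeriv {f : Cn n → ℂ} (hf : Holo f) (j : ℕ) :
    Holo (BergmanBall.radialDeriv^[j] f) ∧
      Set.EqOn (BergmanBall.radialDeriv^[j] f) (mulOp (fun k => (k : ℂ) ^ j) f) (unitBall n) := by
  induction j generalizing f with
  | zero =>
    refine ⟨hf, fun z hz => ?_⟩
    simpa using (mulOp_one hf (by simpa using hz)).symm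
  | succ j ih =>
    obtain ⟨h1, h2⟩ := ih hf.radialDeriv
    refine ⟨h1, fun z hz => ?_⟩
    rw [Function.iterate_succ_apply, h2 hz, mulOp_congr (g := mulOp (fun k => (k : ℂ)) f)
      (fun w hw => radialDeriv_eq_mulOp hf (by simpa using hw)), mulOp_mulOp hf subExp_natCast]
    simp only [pow_succ]

end Multipliers

end BergmanBall

/-! ### The sub-mean value property of `|f| ^ p`. -/

/-- Jensen's formula makes `log |f|` subharmonic, and `|f| ^ p` is its composition with the
increasing convex function `u ↦ exp (p * u)`. Convexity is used through the tangent line at `log |f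
0|`. -/
theorem norm_rpow_le_circleAverage {f : ℂ → ℂ} (hf : AnalyticOnNhd ℂ f (closedBall 0 1)) {p : ℝ}
    (hp : 0 < p) : ‖f 0‖ ^ p ≤ Real.circleAverage (fun z => ‖f z‖ ^ p) 0 1 := by
  rcases eq_or_ne (f 0) 0 with h0 | h0
  · rw [h0, norm_zero, Real.zero_rpow hp.ne']
    exact Real.circleAverage_nonneg_of_nonneg fun x _ => by positivity
  have ha : 0 < ‖f 0‖ := norm_pos_iff.2 h0
  set L : ℂ → ℝ := fun z => Real.log ‖f z‖ with hL
  have hf' : AnalyticOnNhd ℂ f (closedBall 0 |1|) := by simpa using hf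
  have hmer : MeromorphicOn f (sphere 0 |1|) :=
    (hf'.mono sphere_subset_closedBall).meromorphicOn
  have hLint : CircleIntegrable L 0 1 := hmer.circleIntegrable_log_norm
  have hLavg : Real.log ‖f 0‖ ≤ Real.circleAverage L 0 1 := by
    rw [hL, AnalyticOnNhd.circleAverage_log_norm one_ne_zero hf' h0]
    refine le_add_of_nonneg_left (finsum_nonneg fun u => ?_)
    by_cases hu : u ∈ closedBall (0 : ℂ) |1|
    · refine mul_nonneg ?_ ?_
      · exact_mod_cast MeromorphicOn.AnalyticOnNhd.divisor_nonneg hf' u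
      · rcases eq_or_ne u 0 with rfl | hu0
        · simp
        · refine Real.log_nonneg ?_
          rw [one_mul, zero_sub, norm_neg]
          exact (one_le_inv₀ (norm_pos_iff.2 hu0)).2 (by simpa using hu)
    · rw [Function.locallyFinsuppWithin.apply_eq_zero_of_notMem _ hu]; simp
  set a := ‖f 0‖
  -- The tangent line to `u ↦ exp (p * u)` at `log a`, evaluated at `log |f z|`.
  let G : ℂ → ℝ := fun z => a ^ p * (1 - p * Real.log a) + (a ^ p * p) * L z
  have hGint : CircleIntegrable G 0 1 :=
    (circleIntegrable_const _ _ _).add (hLint.const_mul _)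
  -- At zeros of `f` the convention `Real.log 0 = 0` may put `G` above `|f| ^ p`. Changing the
  -- function there affects only a discrete set and leaves the average unchanged.
  let H : ℂ → ℝ := fun z => if f z = 0 then G z else ‖f z‖ ^ p
  have hHeq : (fun z => ‖f z‖ ^ p) =ᶠ[Filter.codiscreteWithin (sphere 0 |1|)] H := by
    have h1 := hf'.preimage_zero_mem_codiscreteWithin h0 (by simp)
      ((convex_closedBall (0 : ℂ) |1|).isConnected ⟨0, by simp⟩)
    have h2 := Filter.codiscreteWithin_mono (sphere_subset_closedBall (x := (0 : ℂ)) (ε := |1|)) h1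
    filter_upwards [h2] with z hz
    have : f z ≠ 0 := by simpa using hz
    simp [H, this]
  have hcont : ContinuousOn (fun z => ‖f z‖ ^ p) (sphere 0 |1|) :=
    ((hf'.continuousOn.mono sphere_subset_closedBall).norm).rpow_const fun _ _ => Or.inr hp.le
  have hint : CircleIntegrable (fun z => ‖f z‖ ^ p) 0 1 :=
    ContinuousOn.circleIntegrable' hcont
  have hHint : CircleIntegrable H 0 1 := CircleIntegrable.congr_codiscreteWithin hHeq hint
  rw [Real.circleAverage_congr_codiscreteWithin hHeq one_ne_zero]
  have hGH : Real.circleAverage G 0 1 ≤ Real.circleAverage H 0 1 := by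
    refine Real.circleAverage_mono hGint hHint fun z _ => ?_
    by_cases hz : f z = 0
    · simp [H, hz]
    · have hz' : 0 < ‖f z‖ := norm_pos_iff.2 hz
      have h1 := Real.add_one_le_exp (p * (L z - Real.log a))
      have h2 : ‖f z‖ ^ p = a ^ p * Real.exp (p * (L z - Real.log a)) := by
        rw [Real.rpow_def_of_pos hz', Real.rpow_def_of_pos ha, ← Real.exp_add]
        congr 1
        simp only [L]; ring
      have h3 : 0 ≤ a ^ p := by positivity
      simp only [H, hz, if_false, h2, G]
      nlinarith
  refine le_trans ?_ hGH
  have hG : Real.circleAverage G 0 1 =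
      a ^ p * (1 - p * Real.log a) + (a ^ p * p) * Real.circleAverage L 0 1 := by
    have h := Real.circleAverage_fun_add (circleIntegrable_const (a ^ p * (1 - p * Real.log a)) 0 1)
      (f₂ := (a ^ p * p) • L) (hLint.const_mul (a ^ p * p))
    rw [Real.circleAverage_const, Real.circleAverage_smul] at h
    exact h
  rw [hG]
  have h3 : 0 ≤ a ^ p * p := by positivity
  nlinarith

namespace BergmanBall
variable {n : ℕ}

theorem finrank_Cn : Module.finrank ℝ (Cn n) = 2 * n := by
  have := Module.finrank_mul_finrank ℝ ℂ (Cn n)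
  rw [← this, Complex.finrank_real_complex, finrank_euclideanSpace_fin]

theorem measurePreserving_unit_smul {c : ℂ} (hc : ‖c‖ = 1) :
    MeasurePreserving (fun z : Cn n => c • z) volume volume := by
  have hc0 : c ≠ 0 := by rintro rfl; simp at hc
  let e : Cn n ≃ₗᵢ[ℝ] Cn n :=
    { (LinearEquiv.smulOfNeZero ℂ (Cn n) c hc0).restrictScalars ℝ with
      norm_map' := fun z => by
        change ‖c • z‖ = ‖z‖
        rw [norm_smul, hc, one_mul] }
  exact e.measurePreserving

theorem measurable_indicator_of_continuousOn {X Y : Type*} [TopologicalSpace X]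
    [MeasurableSpace X] [BorelSpace X] [TopologicalSpace Y] [MeasurableSpace Y] [BorelSpace Y]
    [Zero Y] {s : Set X} (hs : MeasurableSet s) {f : X → Y} (hf : ContinuousOn f s) :
    Measurable (s.indicator f) := by
  classical
  rw [← Set.piecewise_eq_indicator]
  exact hf.measurable_piecewise continuousOn_const hs

theorem continuousOn_enorm_rpow {f : Cn n → ℂ} {s : Set (Cn n)} (hf : ContinuousOn f s) (p : ℝ) :
    ContinuousOn (fun z => ‖f z‖ₑ ^ p) s :=
  (ENNReal.continuous_rpow_const.comp continuous_enorm).comp_continuousOn hf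

theorem enorm_rpow_le_lintegral_circle {g : Cn n → ℂ} {U : Set (Cn n)} (hU : IsOpen U)
    (hg : DifferentiableOn ℂ g U) {w ξ : Cn n} (h : closedBall w ‖ξ‖ ⊆ U) {p : ℝ} (hp : 0 < p) :
    ENNReal.ofReal (2 * Real.pi) * ‖g w‖ₑ ^ p ≤
      ∫⁻ θ in Set.Ioc 0 (2 * Real.pi), ‖g (w + circleMap 0 1 θ • ξ)‖ₑ ^ p := by
  have hpi : (0 : ℝ) ≤ 2 * Real.pi := by positivity
  have hmem : ∀ c : ℂ, ‖c‖ ≤ 1 → w + c • ξ ∈ U := by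
    intro c hc
    refine h ?_
    rw [mem_closedBall_iff_norm, add_sub_cancel_left, norm_smul]
    exact mul_le_of_le_one_left (norm_nonneg _) hc
  have hV : IsOpen ((fun c : ℂ => w + c • ξ) ⁻¹' U) := hU.preimage (by fun_prop)
  have hf : AnalyticOnNhd ℂ (fun c : ℂ => g (w + c • ξ)) (closedBall 0 1) :=
    ((differentiableOn_slice hg w ξ fun c hc => hc).analyticOnNhd hV).mono
      fun c hc => hmem c (by simpa using hc)
  have h1 := norm_rpow_le_circleAverage hf hp
  simp only [zero_smul, add_zero] at h1
  rw [Real.circleAverage_def, smul_eq_mul, ← div_eq_inv_mul, le_div_iff₀ (by positivity),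
    intervalIntegral.integral_of_le hpi] at h1
  have hcont : Continuous fun θ : ℝ => ‖g (w + circleMap 0 1 θ • ξ)‖ ^ p := by
    refine Continuous.rpow_const ?_ fun _ => Or.inr hp.le
    exact (hg.continuousOn.comp_continuous (by fun_prop) fun θ => hmem _ (by simp)).norm
  have hi : Integrable (fun θ : ℝ => ‖g (w + circleMap 0 1 θ • ξ)‖ ^ p)
      (volume.restrict (Set.Ioc 0 (2 * Real.pi))) :=
    (hcont.intervalIntegrable 0 (2 * Real.pi)).1
  have h2 := ENNReal.ofReal_le_ofReal h1
  rw [ofReal_integral_eq_lintegral_ofReal hi (Filter.Eventually.of_forall fun θ => by positivity),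
    ENNReal.ofReal_mul (by positivity), mul_comm] at h2
  simpa only [← ENNReal.ofReal_rpow_of_nonneg (norm_nonneg _) hp.le, ofReal_norm] using h2

/-- Sub-mean value property of `|g|^p` on balls of `ℂⁿ`. -/
theorem enorm_rpow_mul_volume_le {g : Cn n → ℂ} {U : Set (Cn n)} (hU : IsOpen U)
    (hg : DifferentiableOn ℂ g U) {w : Cn n} {r : ℝ} (h : closedBall w r ⊆ U) {p : ℝ}
    (hp : 0 < p) :
    ‖g w‖ₑ ^ p * volume (ball (0 : Cn n) r) ≤ ∫⁻ u in ball w r, ‖g u‖ₑ ^ p := by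
  let φ : Cn n → ℝ≥0∞ := (ball w r).indicator fun u => ‖g u‖ₑ ^ p
  have hφ : Measurable φ := measurable_indicator_of_continuousOn measurableSet_ball
    (continuousOn_enorm_rpow (hg.continuousOn.mono (ball_subset_closedBall.trans h)) p)
  have hpi : ENNReal.ofReal (2 * Real.pi) ≠ 0 := by
    simp [Real.pi_pos]
  -- Lebesgue measure is invariant under the rotations `ξ ↦ exp (i θ) • ξ`. Averaging the
  -- one-variable inequality over `ξ` thus makes the circle integral redundant.
  have hrot : ∀ θ : ℝ, ∫⁻ ξ, φ (w + circleMap 0 1 θ • ξ) = ∫⁻ u, φ u := by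
    intro θ
    have h1 := (measurePreserving_unit_smul (n := n) (c := circleMap 0 1 θ) (by simp)).lintegral_comp
      (f := fun u => φ (w + u)) (hφ.comp (measurable_const_add w))
    rw [h1]
    exact lintegral_add_left_eq_self φ w
  have hmeas : Measurable (Function.uncurry fun (ξ : Cn n) (θ : ℝ) =>
      φ (w + circleMap 0 1 θ • ξ)) := by
    refine hφ.comp ?_
    refine Continuous.measurable ?_
    fun_prop
  have key : ∫⁻ ξ in ball (0 : Cn n) r, ENNReal.ofReal (2 * Real.pi) * ‖g w‖ₑ ^ p ≤
      ENNReal.ofReal (2 * Real.pi) * ∫⁻ u, φ u := by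
    calc ∫⁻ ξ in ball (0 : Cn n) r, ENNReal.ofReal (2 * Real.pi) * ‖g w‖ₑ ^ p
        ≤ ∫⁻ ξ in ball (0 : Cn n) r, ∫⁻ θ in Set.Ioc 0 (2 * Real.pi),
            φ (w + circleMap 0 1 θ • ξ) := by
          refine setLIntegral_mono' measurableSet_ball fun ξ hξ => ?_
          rw [mem_ball_zero_iff] at hξ
          refine (enorm_rpow_le_lintegral_circle hU hg
            ((closedBall_subset_closedBall hξ.le).trans h) hp).trans_eq ?_
          refine lintegral_congr fun θ => ?_
          simp only [φ]
          rw [Set.indicator_of_mem]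
          rw [mem_ball_iff_norm, add_sub_cancel_left, norm_smul]
          simpa using hξ
      _ ≤ ∫⁻ ξ, ∫⁻ θ in Set.Ioc 0 (2 * Real.pi), φ (w + circleMap 0 1 θ • ξ) :=
          setLIntegral_le_lintegral _ _
      _ = ∫⁻ θ in Set.Ioc 0 (2 * Real.pi), ∫⁻ ξ, φ (w + circleMap 0 1 θ • ξ) :=
          lintegral_lintegral_swap hmeas.aemeasurable
      _ = ENNReal.ofReal (2 * Real.pi) * ∫⁻ u, φ u := by
          simp only [hrot, lintegral_const, Measure.restrict_apply MeasurableSet.univ,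
            Set.univ_inter, Real.volume_Ioc, sub_zero]
          rw [mul_comm]
  rw [setLIntegral_const, mul_assoc, ENNReal.mul_le_mul_iff_right hpi ENNReal.ofReal_ne_top,
    lintegral_indicator measurableSet_ball] at key
  exact key

end BergmanBall

/-! ### Polar coordinates, spherical caps and nontangential regions. -/

theorem lintegral_eq_lintegral_toSphere {E : Type*} [NormedAddCommGroup E] [NormedSpace ℝ E]
    [MeasurableSpace E] [BorelSpace E] [FiniteDimensional ℝ E] [Nontrivial E] (μ : Measure E)
    [μ.IsAddHaarMeasure] {f : E → ℝ≥0∞} (hf : Measurable f) :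
    ∫⁻ x, f x ∂μ = ∫⁻ ζ : sphere (0 : E) 1, (∫⁻ r in Set.Ioi (0 : ℝ),
      ENNReal.ofReal (r ^ (Module.finrank ℝ E - 1)) * f (r • (ζ : E))) ∂μ.toSphere := by
  have h1 := μ.measurePreserving_homeomorphUnitSphereProd
  have hF : Measurable fun q : sphere (0 : E) 1 × Set.Ioi (0 : ℝ) => f ((q.2 : ℝ) • (q.1 : E)) :=
    hf.comp (by fun_prop)
  have h2 := h1.lintegral_comp hF
  have h3 : ∀ x : ({0}ᶜ : Set E), f (((homeomorphUnitSphereProd E x).2 : ℝ) •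
      ((homeomorphUnitSphereProd E x).1 : E)) = f x := by
    intro x
    rw [← homeomorphUnitSphereProd_symm_apply_coe, Homeomorph.symm_apply_apply]
  simp only [h3] at h2
  rw [lintegral_subtype_comap (measurableSet_singleton (0 : E)).compl f,
    restrict_compl_singleton] at h2
  rw [h2, lintegral_prod _ hF.aemeasurable]
  refine lintegral_congr fun ζ => ?_
  have hm : Measurable fun r : Set.Ioi (0 : ℝ) => f ((r : ℝ) • (ζ : E)) := hf.comp (by fun_prop)
  rw [Measure.volumeIoiPow, lintegral_withDensity_eq_lintegral_mul _ (by fun_prop) hm]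
  exact lintegral_subtype_comap measurableSet_Ioi
    fun r : ℝ => ENNReal.ofReal (r ^ (Module.finrank ℝ E - 1)) * f (r • (ζ : E))

namespace BergmanBall
variable {n : ℕ}

theorem lintegral_one_sub_rpow {γ : ℝ} (hγ : -1 < γ) {s : ℝ} (hs : 0 ≤ s) :
    ∫⁻ r in Set.Ioo (1 - s) 1, ENNReal.ofReal ((1 - r) ^ γ) =
      ENNReal.ofReal (s ^ (γ + 1) / (γ + 1)) := by
  have h1 : IntervalIntegrable (fun r : ℝ => (1 - r) ^ γ) volume (1 - s) 1 := by
    have := (intervalIntegral.intervalIntegrable_rpow' (a := s) (b := 0) hγ).comp_sub_left 1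
    simpa using this
  have h2 : ∫ r in (1 - s)..1, (1 - r) ^ γ = s ^ (γ + 1) / (γ + 1) := by
    rw [intervalIntegral.integral_comp_sub_left (fun r : ℝ => r ^ γ)]
    rw [integral_rpow (Or.inl hγ)]
    simp [Real.zero_rpow (by linarith : γ + 1 ≠ 0)]
  rw [← h2, intervalIntegral.integral_of_le (by linarith), ← restrict_Ioo_eq_restrict_Ioc,
    ofReal_integral_eq_lintegral_ofReal]
  · rw [restrict_Ioo_eq_restrict_Ioc]; exact h1.1
  · filter_upwards [ae_restrict_mem measurableSet_Ioo] with r hr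
    exact Real.rpow_nonneg (by linarith [hr.2]) _

/-- The surface measure of a spherical cap of size comparable to the distance of its centre to the
sphere. -/
theorem exists_toSphere_cap_le (hn : 0 < n) : ∃ C : ℝ, 0 < C ∧ ∀ w : Cn n, ‖w‖ < 1 →
    (volume : Measure (Cn n)).toSphere {ζ | ‖(ζ : Cn n) - w‖ ≤ 25 * (1 - ‖w‖)} ≤
      ENNReal.ofReal (C * (1 - ‖w‖) ^ (2 * (n : ℝ) - 1)) := by
  have : Nonempty (Fin n) := ⟨⟨0, hn⟩⟩
  have : Nontrivial (Cn n) := inferInstance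
  set v := (volume : Measure (Cn n)).real (ball 0 1)
  have hv : 0 < v :=
    ENNReal.toReal_pos (measure_ball_pos volume 0 one_pos).ne' measure_ball_lt_top.ne
  set c : ℝ := (1 / 2) ^ (2 * n - 1) with hc
  have hc0 : 0 < c := by positivity
  refine ⟨2 * 27 ^ (2 * n) * v / c, by positivity, fun w hw => ?_⟩
  set ρ := 1 - ‖w‖ with hρ
  have hρ0 : 0 < ρ := by simp only [hρ]; linarith
  have hρ1 : ρ ≤ 1 := by simp only [hρ]; linarith [norm_nonneg w]
  set K : Set (sphere (0 : Cn n) 1) := {ζ | ‖(ζ : Cn n) - w‖ ≤ 25 * ρ}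
  have hK : MeasurableSet K := measurableSet_le (by fun_prop) measurable_const
  set σ := (volume : Measure (Cn n)).toSphere
  have hlow : ∫⁻ r in Set.Ioi (0 : ℝ), (Set.Ioo (1 - ρ / 2) 1).indicator
      (fun _ => ENNReal.ofReal c) r = ENNReal.ofReal (c * (ρ / 2)) := by
    rw [lintegral_indicator measurableSet_Ioo, setLIntegral_const,
      Measure.restrict_apply measurableSet_Ioo, Set.inter_eq_left.2, Real.volume_Ioo,
      ENNReal.ofReal_mul hc0.le]
    · congr 2; ring
    · intro r hr
      exact Set.mem_Ioi.2 (by linarith [hr.1])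
  -- Thickening the cap radially by `ρ / 2` gives a set inside `ball w (27 * ρ)`, since `25 + 1 / 2
  -- < 27`. On it `r ≥ 1 / 2`, so the density `r ^ (2 * n - 1)` is at least `c`; comparing volumes
  -- bounds the cap.
  have key : ENNReal.ofReal (c * (ρ / 2)) * σ K ≤
      ENNReal.ofReal ((27 * ρ) ^ (2 * n) * v) := by
    have h1 := lintegral_eq_lintegral_toSphere (volume : Measure (Cn n))
      (f := (ball w (27 * ρ)).indicator 1) (measurable_one.indicator measurableSet_ball)
    rw [lintegral_indicator_one measurableSet_ball, Measure.addHaar_ball_of_pos _ _ (by positivity),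
      finrank_Cn] at h1
    have h1' : ENNReal.ofReal ((27 * ρ) ^ (2 * n) * v) =
        ENNReal.ofReal ((27 * ρ) ^ (2 * n)) * volume (ball (0 : Cn n) 1) := by
      rw [ENNReal.ofReal_mul (by positivity)]
      simp only [v, measureReal_def]
      rw [ENNReal.ofReal_toReal measure_ball_lt_top.ne]
    rw [h1', h1, ← lintegral_indicator_const hK]
    refine lintegral_mono fun ζ => ?_
    by_cases hζ : ζ ∈ K
    · rw [Set.indicator_of_mem hζ, ← hlow]
      refine setLIntegral_mono' measurableSet_Ioi fun r _ => ?_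
      by_cases hr : r ∈ Set.Ioo (1 - ρ / 2) 1
      · have hmem : r • (ζ : Cn n) ∈ ball w (27 * ρ) := by
          rw [mem_ball_iff_norm]
          have h2 : r • (ζ : Cn n) - w = (ζ - w) - (1 - r) • (ζ : Cn n) := by
            rw [sub_smul, one_smul]; abel
          have h3 : ‖(1 - r) • (ζ : Cn n)‖ = 1 - r := by
            rw [norm_smul, norm_eq_of_mem_sphere, mul_one, Real.norm_of_nonneg]
            linarith [hr.2]
          rw [h2]
          have h4 : ‖(ζ : Cn n) - w‖ ≤ 25 * ρ := hζ
          linarith [norm_sub_le ((ζ : Cn n) - w) ((1 - r) • (ζ : Cn n)), hr.1]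
        rw [Set.indicator_of_mem hr, Set.indicator_of_mem hmem, Pi.one_apply, mul_one]
        refine ENNReal.ofReal_le_ofReal ?_
        rw [hc]
        refine pow_le_pow_left₀ (by norm_num) ?_ _
        linarith [hr.1]
      · rw [Set.indicator_of_notMem hr]; exact zero_le
    · rw [Set.indicator_of_notMem hζ]; exact zero_le
  rw [mul_comm, ← ENNReal.le_div_iff_mul_le (Or.inl (by simp; positivity))
    (Or.inl ENNReal.ofReal_ne_top)] at key
  refine key.trans ?_
  rw [← ENNReal.ofReal_div_of_pos (by positivity)]
  refine ENNReal.ofReal_le_ofReal (le_of_eq ?_)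
  have h5 : ρ ^ (2 * (n : ℝ) - 1) = ρ ^ (2 * n) / ρ := by
    rw [Real.rpow_sub_one hρ0.ne']
    congr 1
    exact_mod_cast Real.rpow_natCast ρ (2 * n)
  rw [h5, mul_pow]
  field_simp

/-- The points `z` of the ball which lie in a nontangential region attached to `w`. -/
def shadow (w : Cn n) : Set (Cn n) := {z | ‖z‖ < 1 ∧ dist z w < 12 * (1 - ‖w‖)}

theorem measurableSet_shadow (w : Cn n) : MeasurableSet (shadow w) := by
  have h1 : MeasurableSet {z : Cn n | ‖z‖ < 1} := measurableSet_lt (by fun_prop) measurable_const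
  have h2 : MeasurableSet {z : Cn n | dist z w < 12 * (1 - ‖w‖)} :=
    measurableSet_lt (by fun_prop) measurable_const
  exact h1.inter h2

/-- In polar coordinates the shadow lies over a cap of radius `25 * ρ`, of measure `O(ρ ^ (2 * n -
1))`, and within `1 - 13 * ρ < r < 1`. The radial integral is `O(ρ ^ (γ + 1))`, also when the weight
blows up at the sphere, because `γ > -1`. -/
theorem exists_lintegral_shadow_le (hn : 0 < n) {γ : ℝ} (hγ : -1 < γ) :
    ∃ C : ℝ, 0 < C ∧ ∀ w : Cn n, ‖w‖ < 1 →
      ∫⁻ z in shadow w, ENNReal.ofReal ((1 - ‖z‖) ^ γ) ≤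
        ENNReal.ofReal (C * (1 - ‖w‖) ^ (γ + 2 * n)) := by
  have : Nonempty (Fin n) := ⟨⟨0, hn⟩⟩
  have : Nontrivial (Cn n) := inferInstance
  obtain ⟨C, hC0, hC⟩ := exists_toSphere_cap_le hn
  have hγ1 : 0 < γ + 1 := by linarith
  refine ⟨C * 13 ^ (γ + 1) / (γ + 1), by positivity, fun w hw => ?_⟩
  set ρ := 1 - ‖w‖ with hρ
  have hρ0 : 0 < ρ := by simp only [hρ]; linarith
  set K : Set (sphere (0 : Cn n) 1) := {ζ | ‖(ζ : Cn n) - w‖ ≤ 25 * ρ}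
  have hK : MeasurableSet K := measurableSet_le (by fun_prop) measurable_const
  have hS : MeasurableSet (shadow w) := measurableSet_shadow w
  rw [← lintegral_indicator hS, lintegral_eq_lintegral_toSphere (volume : Measure (Cn n))
    (Measurable.indicator (by fun_prop) hS)]
  calc _ ≤ ∫⁻ ζ, K.indicator (fun _ => ENNReal.ofReal ((13 * ρ) ^ (γ + 1) / (γ + 1))) ζ
        ∂(volume : Measure (Cn n)).toSphere := by
        refine lintegral_mono fun ζ => ?_
        have hnorm : ∀ r : ℝ, 0 < r → ‖r • (ζ : Cn n)‖ = r := fun r hr => by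
          rw [norm_smul, norm_eq_of_mem_sphere, mul_one, Real.norm_of_nonneg hr.le]
        have hin : ∀ r : ℝ, 0 < r → r • (ζ : Cn n) ∈ shadow w →
            ζ ∈ K ∧ r ∈ Set.Ioo (1 - 13 * ρ) 1 := by
          intro r hr hmem
          obtain ⟨h1, h2⟩ := hmem
          rw [hnorm r hr] at h1
          rw [dist_eq_norm, ← hρ] at h2
          have h3 : 1 - 13 * ρ < r := by
            have h := norm_sub_norm_le w (w - r • (ζ : Cn n))
            rw [sub_sub_cancel, hnorm r hr, norm_sub_rev] at h
            have : ‖w‖ = 1 - ρ := by simp [hρ]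
            linarith
          refine ⟨?_, h3, h1⟩
          have h4 : (ζ : Cn n) - w = (r • (ζ : Cn n) - w) + (1 - r) • (ζ : Cn n) := by
            rw [sub_smul, one_smul]; abel
          have h5 : ‖(1 - r) • (ζ : Cn n)‖ = 1 - r := by
            rw [norm_smul, norm_eq_of_mem_sphere, mul_one, Real.norm_of_nonneg]
            linarith
          change ‖(ζ : Cn n) - w‖ ≤ 25 * ρ
          rw [h4]
          linarith [norm_add_le (r • (ζ : Cn n) - w) ((1 - r) • (ζ : Cn n))]
        by_cases hζ : ζ ∈ K
        · rw [Set.indicator_of_mem hζ, ← lintegral_one_sub_rpow hγ (by positivity),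
            ← lintegral_indicator measurableSet_Ioo]
          refine (setLIntegral_mono' measurableSet_Ioi fun r hr => ?_).trans
            (setLIntegral_le_lintegral _ _)
          by_cases hmem : r • (ζ : Cn n) ∈ shadow w
          · have h6 := hin r hr hmem
            rw [Set.indicator_of_mem hmem, Set.indicator_of_mem h6.2, hnorm r hr]
            refine mul_le_of_le_one_left (zero_le) ?_
            rw [← ENNReal.ofReal_one]
            exact ENNReal.ofReal_le_ofReal (pow_le_one₀ (le_of_lt hr) h6.2.2.le)
          · rw [Set.indicator_of_notMem hmem, mul_zero]; exact zero_le
        · rw [Set.indicator_of_notMem hζ, nonpos_iff_eq_zero]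
          refine (setLIntegral_congr_fun measurableSet_Ioi fun r hr => ?_).trans lintegral_zero
          rw [Set.indicator_of_notMem fun h => hζ (hin r hr h).1, mul_zero]
    _ = ENNReal.ofReal ((13 * ρ) ^ (γ + 1) / (γ + 1)) *
        (volume : Measure (Cn n)).toSphere K := lintegral_indicator_const hK _
    _ ≤ ENNReal.ofReal ((13 * ρ) ^ (γ + 1) / (γ + 1)) *
        ENNReal.ofReal (C * ρ ^ (2 * (n : ℝ) - 1)) := by gcongr; exact hC w hw
    _ = ENNReal.ofReal (C * 13 ^ (γ + 1) / (γ + 1) * ρ ^ (γ + 2 * n)) := by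
        rw [← ENNReal.ofReal_mul (by positivity)]
        congr 1
        have h7 : γ + 2 * n = (γ + 1) + (2 * (n : ℝ) - 1) := by ring
        rw [h7, Real.rpow_add hρ0, Real.mul_rpow (by norm_num) hρ0.le]
        ring

/-- A nontangential approach region with vertex `z`. -/
def stolz (z : Cn n) : Set (Cn n) := {w | ‖w‖ < 1 ∧ dist z w < 12 * (1 - ‖w‖)}

/-- The integral `∫ |f|^p (1 - |z|)^a dv` over the ball. -/
noncomputable def bergmanInt (p a : ℝ) (f : Cn n → ℂ) : ℝ≥0∞ :=
  ∫⁻ z in unitBall n, ‖f z‖ₑ ^ p * ENNReal.ofReal ((1 - ‖z‖) ^ a)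

/-- The integral `∫ |f|^p (1 - |z|)^a dv` over a nontangential region. -/
noncomputable def stolzInt (p a : ℝ) (f : Cn n → ℂ) (z : Cn n) : ℝ≥0∞ :=
  ∫⁻ w in stolz z, ‖f w‖ₑ ^ p * ENNReal.ofReal ((1 - ‖w‖) ^ a)

theorem measurableSet_stolz (z : Cn n) : MeasurableSet (stolz z) := by
  have h1 : MeasurableSet {w : Cn n | ‖w‖ < 1} := measurableSet_lt (by fun_prop) measurable_const
  have h2 : MeasurableSet {w : Cn n | dist z w < 12 * (1 - ‖w‖)} :=
    measurableSet_lt (by fun_prop) (by fun_prop)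
  exact h1.inter h2

theorem exists_rpow_bounds (e : ℝ) : ∃ c C : ℝ, 0 < c ∧ 0 < C ∧ ∀ x y : ℝ, 0 < x →
    x / 2 ≤ y → y ≤ 2 * x → c * x ^ e ≤ y ^ e ∧ y ^ e ≤ C * x ^ e := by
  refine ⟨min ((1 / 2) ^ e) (2 ^ e), max ((1 / 2) ^ e) (2 ^ e), by positivity, by positivity,
    fun x y hx h1 h2 => ?_⟩
  have hy : 0 < y := by linarith
  have hq0 : 0 < y / x := by positivity
  have h3 : 1 / 2 ≤ y / x := by rw [le_div_iff₀ hx]; linarith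
  have h4 : y / x ≤ 2 := by rw [div_le_iff₀ hx]; linarith
  have hyx : y ^ e = (y / x) ^ e * x ^ e := by
    rw [← Real.mul_rpow hq0.le hx.le, div_mul_cancel₀ _ hx.ne']
  have hxe : 0 ≤ x ^ e := by positivity
  rw [hyx]
  rcases le_total 0 e with he | he
  · exact ⟨mul_le_mul_of_nonneg_right ((min_le_left _ _).trans
      (Real.rpow_le_rpow (by norm_num) h3 he)) hxe, mul_le_mul_of_nonneg_right
      ((Real.rpow_le_rpow hq0.le h4 he).trans (le_max_right _ _)) hxe⟩
  · exact ⟨mul_le_mul_of_nonneg_right ((min_le_right _ _).trans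
      (Real.rpow_le_rpow_of_nonpos hq0 h4 he)) hxe, mul_le_mul_of_nonneg_right
      ((Real.rpow_le_rpow_of_nonpos (by norm_num) h3 he).trans (le_max_left _ _)) hxe⟩

/-- The sub-mean value property on the ball of radius `(1 - ‖w‖) / 2` about `w`, on which `1 - ‖u‖`
is comparable to `1 - ‖w‖`. The volume of that ball accounts for the shift of the exponent by `2 *
n`. -/
theorem exists_pointwise_le_stolzInt {p : ℝ} (hp : 0 < p) (e : ℝ) :
    ∃ C : ℝ, 0 < C ∧ ∀ g : Cn n → ℂ, Holo g → ∀ z w : Cn n, ‖w‖ < 1 →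
      dist z w ≤ 5 * (1 - ‖w‖) → ‖g w‖ₑ ^ p * ENNReal.ofReal ((1 - ‖w‖) ^ e) ≤
        ENNReal.ofReal C * stolzInt p (e - 2 * n) g z := by
  obtain ⟨c, _, hc0, _, hc⟩ := exists_rpow_bounds (e - 2 * n)
  set v := (volume : Measure (Cn n)).real (ball 0 1)
  have hv : 0 < v :=
    ENNReal.toReal_pos (measure_ball_pos volume 0 one_pos).ne' measure_ball_lt_top.ne
  refine ⟨2 ^ (2 * n) / (c * v), by positivity, fun g hg z w hw hzw => ?_⟩
  set ρ := 1 - ‖w‖ with hρ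
  have hρ0 : 0 < ρ := by simp only [hρ]; linarith
  have hdist : ∀ u ∈ closedBall w (ρ / 2), ρ / 2 ≤ 1 - ‖u‖ ∧ 1 - ‖u‖ ≤ 2 * ρ := by
    intro u hu
    rw [mem_closedBall_iff_norm] at hu
    have h1 := norm_sub_norm_le u w
    have h2 := norm_sub_norm_le w u
    rw [norm_sub_rev] at h2
    constructor <;> linarith
  have hsub : closedBall w (ρ / 2) ⊆ unitBall n := fun u hu => by
    rw [mem_ball_zero_iff]; linarith [(hdist u hu).1]
  -- Here the aperture `12` is fixed: `5 * ρ + ρ / 2 ≤ 11 * (1 - ‖u‖)`.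
  have hstolz : ball w (ρ / 2) ⊆ stolz z := fun u hu => by
    have h1 := hdist u (ball_subset_closedBall hu)
    refine ⟨by linarith, ?_⟩
    rw [mem_ball, dist_comm] at hu
    linarith [dist_triangle z w u]
  have hmean := enorm_rpow_mul_volume_le isOpen_ball hg hsub hp
  rw [Measure.addHaar_ball_of_pos _ _ (by positivity), finrank_Cn,
    ← ENNReal.ofReal_toReal (measure_ball_lt_top (μ := (volume : Measure (Cn n)))).ne,
    ← measureReal_def, ← ENNReal.ofReal_mul (by positivity)] at hmean
  calc ‖g w‖ₑ ^ p * ENNReal.ofReal (ρ ^ e)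
      = ENNReal.ofReal (2 ^ (2 * n) / (c * v)) * (ENNReal.ofReal (c * ρ ^ (e - 2 * n)) *
        (‖g w‖ₑ ^ p * ENNReal.ofReal ((ρ / 2) ^ (2 * n) * v))) := by
        rw [mul_left_comm (ENNReal.ofReal (c * ρ ^ (e - 2 * n))),
          mul_left_comm (ENNReal.ofReal (2 ^ (2 * n) / (c * v))),
          ← ENNReal.ofReal_mul (by positivity), ← ENNReal.ofReal_mul (by positivity)]
        congr 2
        have h5 : ρ ^ (e - 2 * n) = ρ ^ e / ρ ^ (2 * n) := by
          rw [Real.rpow_sub hρ0]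
          congr 1
          exact_mod_cast Real.rpow_natCast ρ (2 * n)
        rw [h5, div_pow]
        field_simp
    _ ≤ ENNReal.ofReal (2 ^ (2 * n) / (c * v)) * (ENNReal.ofReal (c * ρ ^ (e - 2 * n)) *
        ∫⁻ u in ball w (ρ / 2), ‖g u‖ₑ ^ p) := by gcongr
    _ ≤ _ := by
        gcongr
        rw [← lintegral_const_mul' _ _ ENNReal.ofReal_ne_top]
        refine (setLIntegral_mono' measurableSet_ball fun u hu => ?_).trans
          (lintegral_mono_set hstolz)
        rw [mul_comm]
        gcongr
        have h1 := hdist u (ball_subset_closedBall hu)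
        exact (hc ρ (1 - ‖u‖) hρ0 h1.1 h1.2).1

/-- Tonelli's theorem: `w ∈ stolz z` exactly when `z ∈ shadow w`, for points of the ball, so the
inner integral becomes the one over the shadow. -/
theorem exists_lintegral_stolzInt_le (hn : 0 < n) {γ : ℝ} (hγ : -1 < γ) (p σ : ℝ) :
    ∃ C : ℝ, 0 < C ∧ ∀ g : Cn n → ℂ, Holo g →
      ∫⁻ z in unitBall n, ENNReal.ofReal ((1 - ‖z‖) ^ γ) * stolzInt p σ g z ≤
        ENNReal.ofReal C * bergmanInt p (σ + γ + 2 * n) g := by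
  obtain ⟨C, hC0, hC⟩ := exists_lintegral_shadow_le hn hγ
  refine ⟨C, hC0, fun g hg => ?_⟩
  let F : Cn n → ℝ≥0∞ := fun w =>
    (unitBall n).indicator (fun w => ‖g w‖ₑ ^ p) w * ENNReal.ofReal ((1 - ‖w‖) ^ σ)
  have hF : Measurable F := (measurable_indicator_of_continuousOn measurableSet_ball
    (continuousOn_enorm_rpow hg.continuousOn p)).mul (by fun_prop)
  let T : Set (Cn n × Cn n) := {q | dist q.1 q.2 < 12 * (1 - ‖q.2‖)}
  have hT : MeasurableSet T := measurableSet_lt (by fun_prop) (by fun_prop)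
  let Φ : Cn n × Cn n → ℝ≥0∞ := T.indicator fun q => ENNReal.ofReal ((1 - ‖q.1‖) ^ γ) * F q.2
  have hΦ : Measurable Φ :=
    Measurable.indicator (Measurable.mul (by fun_prop) (hF.comp measurable_snd)) hT
  calc _ = ∫⁻ z in unitBall n, ∫⁻ w in unitBall n, Φ (z, w) := by
        refine lintegral_congr fun z => ?_
        rw [stolzInt, ← lintegral_indicator (measurableSet_stolz z),
          ← lintegral_indicator measurableSet_ball,
          ← lintegral_const_mul' _ _ ENNReal.ofReal_ne_top]
        refine lintegral_congr fun w => ?_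
        by_cases h1 : w ∈ unitBall n
        · have h1' : ‖w‖ < 1 := by simpa using h1
          rw [Set.indicator_of_mem h1]
          by_cases h2 : (z, w) ∈ T
          · simp only [Φ, F]
            rw [Set.indicator_of_mem (show w ∈ stolz z from ⟨h1', h2⟩), Set.indicator_of_mem h2,
              Set.indicator_of_mem h1]
          · simp only [Φ]
            rw [Set.indicator_of_notMem (fun h : w ∈ stolz z => h2 h.2),
              Set.indicator_of_notMem h2, mul_zero]
        · rw [Set.indicator_of_notMem h1, Set.indicator_of_notMem
            (fun h : w ∈ stolz z => h1 (by simpa using h.1)), mul_zero]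
    _ = ∫⁻ w in unitBall n, ∫⁻ z in unitBall n, Φ (z, w) :=
        lintegral_lintegral_swap hΦ.aemeasurable
    _ ≤ ∫⁻ w in unitBall n, ENNReal.ofReal C *
          (‖g w‖ₑ ^ p * ENNReal.ofReal ((1 - ‖w‖) ^ (σ + γ + 2 * n))) := by
        refine setLIntegral_mono' measurableSet_ball fun w hw => ?_
        have hw' : ‖w‖ < 1 := by simpa using hw
        have hρ0 : 0 < 1 - ‖w‖ := by linarith
        have h3 : ∫⁻ z in unitBall n, Φ (z, w) =
            (∫⁻ z in shadow w, ENNReal.ofReal ((1 - ‖z‖) ^ γ)) * F w := by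
          rw [← lintegral_mul_const _ (by fun_prop), ← lintegral_indicator (measurableSet_shadow w),
            ← lintegral_indicator measurableSet_ball]
          refine lintegral_congr fun z => ?_
          by_cases h1 : z ∈ unitBall n
          · have h1' : ‖z‖ < 1 := by simpa using h1
            rw [Set.indicator_of_mem h1]
            by_cases h2 : (z, w) ∈ T
            · simp only [Φ]
              rw [Set.indicator_of_mem (show z ∈ shadow w from ⟨h1', h2⟩), Set.indicator_of_mem h2]
            · simp only [Φ]
              rw [Set.indicator_of_notMem (fun h : z ∈ shadow w => h2 h.2),
                Set.indicator_of_notMem h2]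
          · rw [Set.indicator_of_notMem h1, Set.indicator_of_notMem
              (fun h : z ∈ shadow w => h1 (by simpa using h.1))]
        rw [h3]
        refine (mul_le_mul_left (hC w hw') _).trans_eq ?_
        simp only [F]
        rw [Set.indicator_of_mem hw, mul_left_comm, ← ENNReal.ofReal_mul (by positivity),
          mul_left_comm (ENNReal.ofReal C), ← ENNReal.ofReal_mul hC0.le]
        congr 2
        rw [show σ + γ + 2 * n = (γ + 2 * n) + σ by ring,
          Real.rpow_add hρ0 (γ + 2 * n) σ]
        ring
    _ = _ := by rw [lintegral_const_mul' _ _ ENNReal.ofReal_ne_top, bergmanInt]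

/-! ### Bounded multipliers between weighted spaces; linear symbols. -/

/-- `m` defines a bounded radial multiplier between Bergman spaces with standard weights. -/
def IsMult (n : ℕ) (p a b : ℝ) (m : ℕ → ℂ) : Prop :=
  SubExp m ∧ ∃ C : ℝ, 0 < C ∧ ∀ g : Cn n → ℂ, Holo g →
    bergmanInt p b (mulOp m g) ≤ ENNReal.ofReal C * bergmanInt p a g

theorem IsMult.comp {p a b c : ℝ} {m m' : ℕ → ℂ} (h' : IsMult n p b c m') (h : IsMult n p a b m) :
    IsMult n p a c fun k => m' k * m k := by
  obtain ⟨hm, C, hC0, hC⟩ := h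
  obtain ⟨hm', C', hC'0, hC'⟩ := h'
  refine ⟨hm'.mul hm, C' * C, by positivity, fun g hg => ?_⟩
  rw [← mulOp_mulOp hg hm, ENNReal.ofReal_mul hC'0.le, mul_assoc]
  exact (hC' _ (holo_mulOp hg hm)).trans (by gcongr; exact hC g hg)

theorem enorm_rpow_le_of_norm_le {x y : ℂ} {K p : ℝ} (hp : 0 ≤ p) (hK : 0 ≤ K)
    (h : ‖x‖ ≤ K * ‖y‖) : ‖x‖ₑ ^ p ≤ ENNReal.ofReal (K ^ p) * ‖y‖ₑ ^ p := by
  rw [← ENNReal.ofReal_rpow_of_nonneg hK hp, ← ENNReal.mul_rpow_of_nonneg _ _ hp]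
  gcongr
  rw [← ofReal_norm, ← ofReal_norm, ← ENNReal.ofReal_mul hK]
  exact ENNReal.ofReal_le_ofReal h

/-- The operator is `R + A`. A Cauchy estimate on a ball of radius comparable to `1 - ‖z‖` costs one
factor `(1 - ‖z‖)⁻¹`, hence `p` in the exponent. -/
theorem isMult_natCast_add {p a : ℝ} (hn : 0 < n) (hp : 0 < p) (ha : -1 < a) (A : ℂ) :
    IsMult n p a (a + p) fun k => (k : ℂ) + A := by
  refine ⟨subExp_natCast.add (subExp_const A), ?_⟩
  obtain ⟨C₁, hC₁0, hC₁⟩ := exists_pointwise_le_stolzInt (n := n) hp 0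
  obtain ⟨C₂, hC₂0, hC₂⟩ := exists_lintegral_stolzInt_le hn ha p (0 - 2 * n)
  refine ⟨(4 + ‖A‖) ^ p * C₁ * C₂, by positivity, fun g hg => ?_⟩
  have hpt : ∀ z ∈ unitBall n, ‖mulOp (fun k => (k : ℂ) + A) g z‖ₑ ^ p *
      ENNReal.ofReal ((1 - ‖z‖) ^ (a + p)) ≤ ENNReal.ofReal ((4 + ‖A‖) ^ p * C₁) *
        (ENNReal.ofReal ((1 - ‖z‖) ^ a) * stolzInt p (0 - 2 * n) g z) := by
    intro z hz
    rw [mem_ball_zero_iff] at hz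
    set ρ := 1 - ‖z‖ with hρ
    have hρ0 : 0 < ρ := by simp only [hρ]; linarith
    have hρ1 : ρ ≤ 1 := by simp only [hρ]; linarith [norm_nonneg z]
    have hsub : closedBall z (ρ / 4) ⊆ unitBall n := fun u hu => by
      rw [mem_closedBall_iff_norm] at hu
      rw [mem_ball_zero_iff]
      linarith [norm_sub_norm_le u z]
    -- Choosing a maximum point turns the supremum in the Cauchy estimate into a value of `g` at a
    -- single point of the nontangential region.
    obtain ⟨w, hw, hmax⟩ := (isCompact_closedBall z (ρ / 4)).exists_isMaxOn
      ⟨z, mem_closedBall_self (by positivity)⟩ (hg.continuousOn.mono hsub).norm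
    have hmax' : ∀ y ∈ closedBall z (ρ / 4), ‖g y‖ ≤ ‖g w‖ := fun y hy => hmax hy
    have hfd := norm_fderiv_le_of_closedBall isOpen_ball hg (by positivity) hsub hmax'
    have heq : mulOp (fun k => (k : ℂ) + A) g z = fderiv ℂ g z z + A * g z := by
      rw [← radialDeriv_eq_fderiv, radialDeriv_eq_mulOp hg hz, mulOp, mulOp]
      simp only [add_mul]
      rw [(summable_mulOp hg subExp_natCast hz).tsum_add (summable_mulOp hg (subExp_const A) hz),
        tsum_mul_left, (hasSum_homComponent hg hz).tsum_eq]
    have hle : ‖mulOp (fun k => (k : ℂ) + A) g z‖ ≤ ((4 + ‖A‖) / ρ) * ‖g w‖ := by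
      rw [heq]
      have h1 : ‖fderiv ℂ g z z‖ ≤ ‖g w‖ / (ρ / 4) * 1 :=
        (ContinuousLinearMap.le_opNorm _ _).trans (by gcongr)
      have h2 : ‖A * g z‖ ≤ ‖A‖ * ‖g w‖ / ρ := by
        rw [norm_mul, le_div_iff₀ hρ0]
        have := mul_le_mul_of_nonneg_left (hmax' z (mem_closedBall_self (by positivity)))
          (norm_nonneg A)
        exact (mul_le_of_le_one_right (by positivity) hρ1).trans this
      refine (norm_add_le _ _).trans ((add_le_add h1 h2).trans_eq ?_)
      field_simp
    have hwz : dist z w ≤ 5 * (1 - ‖w‖) ∧ ‖w‖ < 1 := by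
      rw [mem_closedBall_iff_norm] at hw
      rw [dist_eq_norm, norm_sub_rev]
      have := norm_sub_norm_le w z
      constructor <;> linarith
    have h3 := hC₁ g hg z w hwz.2 hwz.1
    rw [Real.rpow_zero, ENNReal.ofReal_one, mul_one] at h3
    have h4 : ((4 + ‖A‖) / ρ) ^ p * ρ ^ (a + p) = (4 + ‖A‖) ^ p * ρ ^ a := by
      rw [Real.div_rpow (by positivity) hρ0.le, Real.rpow_add hρ0]
      have : 0 < ρ ^ p := by positivity
      field_simp
    calc _ ≤ ENNReal.ofReal (((4 + ‖A‖) / ρ) ^ p) * ‖g w‖ₑ ^ p * ENNReal.ofReal (ρ ^ (a + p)) := by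
          gcongr
          exact enorm_rpow_le_of_norm_le hp.le (by positivity) hle
      _ = ENNReal.ofReal ((4 + ‖A‖) ^ p * ρ ^ a) * ‖g w‖ₑ ^ p := by
          rw [mul_right_comm, ← ENNReal.ofReal_mul (by positivity), h4]
      _ ≤ ENNReal.ofReal ((4 + ‖A‖) ^ p * ρ ^ a) *
          (ENNReal.ofReal C₁ * stolzInt p (0 - 2 * n) g z) := by gcongr
      _ = _ := by
          rw [ENNReal.ofReal_mul (by positivity), ENNReal.ofReal_mul (by positivity)]
          ring
  calc bergmanInt p (a + p) (mulOp (fun k => (k : ℂ) + A) g)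
      ≤ ∫⁻ z in unitBall n, ENNReal.ofReal ((4 + ‖A‖) ^ p * C₁) *
        (ENNReal.ofReal ((1 - ‖z‖) ^ a) * stolzInt p (0 - 2 * n) g z) :=
        setLIntegral_mono' measurableSet_ball hpt
    _ ≤ ENNReal.ofReal ((4 + ‖A‖) ^ p * C₁) * (ENNReal.ofReal C₂ * bergmanInt p a g) := by
        rw [lintegral_const_mul' _ _ ENNReal.ofReal_ne_top]
        gcongr
        simpa using hC₂ g hg
    _ = _ := by rw [← mul_assoc, ← ENNReal.ofReal_mul (by positivity)]

/-! ### Multipliers given by moments, and Gamma quotients of order at least one. -/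

theorem integral_rpow_le {δ ρ : ℝ} (hδ : 0 < δ) (hρ : 0 < ρ) :
    ∫ x in (1 / 2 : ℝ)..1, (1 + ρ - x) ^ (-1 - δ) ≤ ρ ^ (-δ) / δ := by
  rw [intervalIntegral.integral_comp_sub_left (fun u => u ^ (-1 - δ)),
    integral_rpow (Or.inr ⟨by linarith, ?_⟩)]
  · have h1 : (1 + ρ - 1) = ρ := by ring
    have h2 : -1 - δ + 1 = -δ := by ring
    have h3 : 0 ≤ (1 + ρ - 1 / 2) ^ (-δ) := Real.rpow_nonneg (by linarith) _
    rw [h1, h2, div_neg, ← neg_div, neg_sub]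
    gcongr
    linarith
  · rw [Set.uIcc_of_le (by linarith)]
    intro h
    linarith [h.1]

/-- Multipliers which are, up to an exponentially small error, moments of a density vanishing at `1`
to order `τ - 1`. -/
theorem norm_mulOp_le_of_moment {τ δ K : ℝ} (hτ : 1 ≤ τ) (hδ : 0 < δ) {m e : ℕ → ℂ} {φ : ℝ → ℂ}
    (he : ∀ j, ‖e j‖ ≤ K * (1 / 2) ^ j) (hφi : IntervalIntegrable φ volume (1 / 2) 1)
    (hφ : ∀ x ∈ Set.Ioc (1 / 2 : ℝ) 1, ‖φ x‖ ≤ K * (1 - x) ^ (τ - 1))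
    (hm : ∀ j, m j = e j + ∫ x in (1 / 2 : ℝ)..1, (x : ℂ) ^ j * φ x) {g : Cn n → ℂ} (hg : Holo g)
    {z : Cn n} (hz : ‖z‖ < 1) {q : ℝ} (hq : 0 ≤ q)
    (hgq : ∀ w : Cn n, ‖w‖ < 1 → dist z w ≤ 5 * (1 - ‖w‖) → ‖g w‖ * (1 - ‖w‖) ^ (τ + δ) ≤ q) :
    ‖mulOp m g z‖ ≤ (K * 3 ^ (τ + δ) * 4 + K * 2 ^ (1 + δ) / δ) * q * (1 - ‖z‖) ^ (-δ) := by
  have hK : 0 ≤ K := by simpa using (norm_nonneg _).trans (he 0)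
  set ρ := 1 - ‖z‖ with hρ
  have hρ0 : 0 < ρ := by simp only [hρ]; linarith
  have hρ1 : ρ ≤ 1 := by simp only [hρ]; linarith [norm_nonneg z]
  have h12 : (1 / 2 : ℝ) ≤ 1 := by norm_num
  -- The aperture `5` comes from here: `‖z - w‖ ≤ 1 + 2 / 3 = 5 * (1 / 3)`, so the ball of radius `2
  -- / 3` lies in the region for every `z`. As `2 / 3 > 1 / 2`, the component bounds `(3 / 2) ^ j`
  -- are beaten by `e j`.
  have hsmall : ∀ w : Cn n, ‖w‖ ≤ 2 / 3 → ‖g w‖ ≤ 3 ^ (τ + δ) * q := by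
    intro w hw
    have h1 : dist z w ≤ 5 * (1 - ‖w‖) := by
      rw [dist_eq_norm]; linarith [norm_sub_le z w]
    have h2 := hgq w (by linarith) h1
    have h3 : (3 : ℝ)⁻¹ ^ (τ + δ) ≤ (1 - ‖w‖) ^ (τ + δ) :=
      Real.rpow_le_rpow (by norm_num) (by linarith) (by linarith)
    rw [Real.inv_rpow (by norm_num)] at h3
    have h4 := (mul_le_mul_of_nonneg_left h3 (norm_nonneg (g w))).trans h2
    rwa [← div_eq_mul_inv, div_le_iff₀ (by positivity), mul_comm] at h4
  have hcomp := norm_homComponent_le hg (by norm_num) (by norm_num) hsmall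
  have hbd1 : ∀ j, ‖e j * homComponent g j z‖ ≤ K * 3 ^ (τ + δ) * q * (3 / 4) ^ j := by
    intro j
    rw [norm_mul]
    calc _ ≤ K * (1 / 2) ^ j * (3 ^ (τ + δ) * q * (1 / (2 / 3)) ^ j) := by
          gcongr
          · exact he j
          · exact (hcomp j z).trans (by gcongr)
      _ = _ := by
          rw [show (3 / 4 : ℝ) = 1 / 2 * (1 / (2 / 3)) by norm_num, mul_pow]; ring
  have hgeo := (hasSum_geometric_of_lt_one (r := (3 / 4 : ℝ)) (by norm_num) (by norm_num)).mul_left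
    (K * 3 ^ (τ + δ) * q)
  have hsum1 : Summable fun j => e j * homComponent g j z :=
    Summable.of_norm_bounded hgeo.summable hbd1
  have hle1 : ‖∑' j, e j * homComponent g j z‖ ≤ K * 3 ^ (τ + δ) * q * 4 := by
    refine (tsum_of_norm_bounded hgeo hbd1).trans_eq ?_
    norm_num
  have hsum2 : HasSum (fun j => ∫ x in (1 / 2 : ℝ)..1, φ x * ((x : ℂ) ^ j * homComponent g j z))
      (∫ x in (1 / 2 : ℝ)..1, φ x * g ((x : ℂ) • z)) := by
    have hs : Summable fun j => ‖homComponent g j z‖ := by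
      obtain ⟨u, hu, h⟩ := exists_homComponent_bound hg (subExp_const 1) (norm_nonneg z) hz
      exact Summable.of_nonneg_of_le (fun _ => norm_nonneg _)
        (fun k => by simpa using h k z le_rfl) hu
    refine intervalIntegral.hasSum_integral_of_dominated_convergence
      (fun j x => ‖φ x‖ * ‖homComponent g j z‖) ?_ ?_ ?_ ?_ ?_
    · intro j
      rw [Set.uIoc_of_le h12]
      exact hφi.1.aestronglyMeasurable.mul (by fun_prop)
    · refine fun j => Filter.Eventually.of_forall fun x hx => ?_
      rw [Set.uIoc_of_le h12] at hx
      rw [norm_mul, norm_mul, norm_pow, Complex.norm_real,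
        Real.norm_of_nonneg (by linarith [hx.1])]
      gcongr
      exact mul_le_of_le_one_left (norm_nonneg _) (pow_le_one₀ (by linarith [hx.1]) hx.2)
    · exact Filter.Eventually.of_forall fun x _ => hs.mul_left _
    · simp only [tsum_mul_left]
      exact hφi.norm.mul_const _
    · refine Filter.Eventually.of_forall fun x hx => ?_
      rw [Set.uIoc_of_le h12] at hx
      have hxz : ‖(x : ℂ) • z‖ < 1 := by
        rw [norm_smul, Complex.norm_real, Real.norm_of_nonneg (by linarith [hx.1])]
        exact (mul_le_of_le_one_left (norm_nonneg z) hx.2).trans_lt hz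
      have := (hasSum_homComponent hg hxz).mul_left (φ x)
      simpa only [homComponent_smul] using this
  have heq : mulOp m g z = (∑' j, e j * homComponent g j z) +
      ∫ x in (1 / 2 : ℝ)..1, φ x * g ((x : ℂ) • z) := by
    rw [← hsum2.tsum_eq, ← hsum1.tsum_add hsum2.summable, mulOp]
    refine tsum_congr fun j => ?_
    rw [hm, add_mul, ← intervalIntegral.integral_mul_const]
    congr 1
    refine intervalIntegral.integral_congr fun x _ => ?_
    ring
  have hrpi : IntervalIntegrable (fun x : ℝ => (1 + ρ - x) ^ (-1 - δ)) volume (1 / 2) 1 := by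
    refine ContinuousOn.intervalIntegrable ?_
    rw [Set.uIcc_of_le h12]
    refine ContinuousOn.rpow_const (by fun_prop) fun x hx => Or.inl ?_
    linarith [hx.2]
  have hle2 : ‖∫ x in (1 / 2 : ℝ)..1, φ x * g ((x : ℂ) • z)‖ ≤
      K * q * 2 ^ (1 + δ) * (ρ ^ (-δ) / δ) := by
    refine (intervalIntegral.norm_integral_le_of_norm_le h12 (Filter.Eventually.of_forall
      fun x hx => ?_) (hrpi.const_mul (K * q * 2 ^ (1 + δ)))).trans ?_
    · have hx0 : 0 < x := by linarith [hx.1]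
      have hnx : ‖(x : ℂ) • z‖ = x * ‖z‖ := by
        rw [norm_smul, Complex.norm_real, Real.norm_of_nonneg hx0.le]
      set y := 1 - x * ‖z‖ with hy
      have hxy : 1 - x ≤ y := by
        have := mul_le_of_le_one_right hx0.le hz.le
        linarith
      -- Uses `x ≥ 1 / 2`, the reason for cutting the moments off at `1 / 2`.
      have hy1 : (1 + ρ - x) / 2 ≤ y := by
        have : y = (1 - x) + x * ρ := by simp only [hy, hρ]; ring
        rw [this]
        nlinarith [hx.1, hx.2, mul_nonneg (by linarith [hx.1] : (0 : ℝ) ≤ x - 1 / 2) hρ0.le]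
      have hu0 : 0 < 1 + ρ - x := by linarith [hx.2]
      have hy0 : 0 < y := by linarith
      have h1 := hgq ((x : ℂ) • z) (by rw [hnx]; linarith) (by
        rw [hnx, ← hy, dist_eq_norm]
        have h2 : z - (x : ℂ) • z = ((1 - x : ℝ) : ℂ) • z := by
          push_cast; rw [sub_smul, one_smul]
        rw [h2, norm_smul, Complex.norm_real, Real.norm_of_nonneg (by linarith [hx.2])]
        have := mul_le_of_le_one_right (by linarith [hx.2] : 0 ≤ 1 - x) hz.le
        linarith)
      rw [hnx, ← hy] at h1
      have h3 : ‖g ((x : ℂ) • z)‖ ≤ q * y ^ (-(τ + δ)) := by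
        rw [Real.rpow_neg hy0.le, ← div_eq_mul_inv, le_div_iff₀ (by positivity)]
        exact h1
      have h4 : (1 - x) ^ (τ - 1) ≤ y ^ (τ - 1) :=
        Real.rpow_le_rpow (by linarith [hx.2]) hxy (by linarith)
      have h5 : y ^ (-1 - δ) ≤ ((1 + ρ - x) / 2) ^ (-1 - δ) :=
        Real.rpow_le_rpow_of_nonpos (by positivity) hy1 (by linarith)
      have h6 : ((1 + ρ - x) / 2) ^ (-1 - δ) = 2 ^ (1 + δ) * (1 + ρ - x) ^ (-1 - δ) := by
        rw [Real.div_rpow hu0.le (by norm_num), show (1 + δ) = -(-1 - δ) by ring,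
          Real.rpow_neg (by norm_num)]
        field_simp
      calc ‖φ x * g ((x : ℂ) • z)‖ ≤ K * y ^ (τ - 1) * (q * y ^ (-(τ + δ))) := by
            rw [norm_mul]
            gcongr
            exact (hφ x hx).trans (by gcongr)
        _ = K * q * y ^ (-1 - δ) := by
            rw [show -1 - δ = (τ - 1) + -(τ + δ) by ring, Real.rpow_add hy0]; ring
        _ ≤ K * q * (2 ^ (1 + δ) * (1 + ρ - x) ^ (-1 - δ)) := by rw [← h6]; gcongr
        _ = _ := by ring
    · rw [intervalIntegral.integral_const_mul]
      gcongr
      exact integral_rpow_le hδ hρ0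
  rw [heq]
  refine (norm_add_le _ _).trans ((add_le_add hle1 hle2).trans ?_)
  have h7 : 1 ≤ ρ ^ (-δ) := Real.one_le_rpow_of_pos_of_le_one_of_nonpos hρ0 hρ1 (by linarith)
  have h8 : K * 3 ^ (τ + δ) * q * 4 ≤ K * 3 ^ (τ + δ) * q * 4 * ρ ^ (-δ) :=
    le_mul_of_one_le_right (by positivity) h7
  refine (add_le_add_left h8 _).trans_eq ?_
  ring

theorem isMult_of_moment (hn : 0 < n) {p a τ K : ℝ} (hp : 0 < p) (hτ : 1 ≤ τ)
    (ha : -1 < a - τ * p) {m e : ℕ → ℂ} {φ : ℝ → ℂ}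
    (he : ∀ j, ‖e j‖ ≤ K * (1 / 2) ^ j) (hφi : IntervalIntegrable φ volume (1 / 2) 1)
    (hφ : ∀ x ∈ Set.Ioc (1 / 2 : ℝ) 1, ‖φ x‖ ≤ K * (1 - x) ^ (τ - 1))
    (hm : ∀ j, m j = e j + ∫ x in (1 / 2 : ℝ)..1, (x : ℂ) ^ j * φ x) :
    IsMult n p a (a - τ * p) m := by
  have hK : 0 ≤ K := by simpa using (norm_nonneg _).trans (he 0)
  have h12 : (1 / 2 : ℝ) ≤ 1 := by norm_num
  refine ⟨SubExp.of_bounded (C := K + K * |1 - 1 / 2|) fun j => ?_, ?_⟩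
  · rw [hm]
    refine (norm_add_le _ _).trans (add_le_add ((he j).trans ?_) ?_)
    · exact mul_le_of_le_one_right hK (pow_le_one₀ (by norm_num) (by norm_num))
    · refine intervalIntegral.norm_integral_le_of_norm_le_const fun x hx => ?_
      rw [Set.uIoc_of_le h12] at hx
      rw [norm_mul, norm_pow, Complex.norm_real, Real.norm_of_nonneg (by linarith [hx.1])]
      refine (mul_le_of_le_one_left (norm_nonneg _)
        (pow_le_one₀ (by linarith [hx.1]) hx.2)).trans ((hφ x hx).trans ?_)
      exact mul_le_of_le_one_right hK (Real.rpow_le_one (by linarith [hx.2])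
        (by linarith [hx.1]) (by linarith))
  set b := a - τ * p with hb
  -- The extra `δ` replaces a logarithmically divergent integral by the power `(1 - ‖z‖) ^ (-δ)`. It
  -- must be small enough that the remaining weight exponent `b - δ * p` still exceeds `-1`.
  obtain ⟨δ, hδ0, hδ⟩ : ∃ δ : ℝ, 0 < δ ∧ -1 < b - δ * p := by
    refine ⟨(b + 1) / (2 * p), div_pos (by linarith) (by positivity), ?_⟩
    have : (b + 1) / (2 * p) * p = (b + 1) / 2 := by field_simp
    rw [this]; linarith
  obtain ⟨C₁, hC₁0, hC₁⟩ := exists_pointwise_le_stolzInt (n := n) hp ((τ + δ) * p)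
  obtain ⟨C₂, hC₂0, hC₂⟩ := exists_lintegral_stolzInt_le hn hδ p ((τ + δ) * p - 2 * n)
  set K' := K * 3 ^ (τ + δ) * 4 + K * 2 ^ (1 + δ) / δ + 1
  have hK'0 : 0 < K' := by positivity
  refine ⟨K' ^ p * C₁ * C₂, by positivity, fun g hg => ?_⟩
  have hpt : ∀ z ∈ unitBall n, ‖mulOp m g z‖ₑ ^ p * ENNReal.ofReal ((1 - ‖z‖) ^ b) ≤
      ENNReal.ofReal (K' ^ p * C₁) * (ENNReal.ofReal ((1 - ‖z‖) ^ (b - δ * p)) *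
        stolzInt p ((τ + δ) * p - 2 * n) g z) := by
    intro z hz
    rw [mem_ball_zero_iff] at hz
    have hρ0 : 0 < 1 - ‖z‖ := by linarith
    set I := stolzInt p ((τ + δ) * p - 2 * n) g z with hI
    rcases eq_or_ne I ⊤ with hIt | hIt
    · rw [hIt, ENNReal.mul_top, ENNReal.mul_top]
      · exact le_top
      · simp only [ne_eq, ENNReal.ofReal_eq_zero, not_le]; positivity
      · simp only [ne_eq, ENNReal.ofReal_eq_zero, not_le]; positivity
    -- The `p`-th root turns the nontangential integral into a pointwise bound for `g` on the
    -- region, as the moment estimate requires.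
    set q : ℝ := (C₁ * I.toReal) ^ (1 / p) with hq
    have hq0 : 0 ≤ q := by positivity
    have hqp : q ^ p = C₁ * I.toReal := by
      rw [hq, ← Real.rpow_mul (by positivity), one_div_mul_cancel hp.ne', Real.rpow_one]
    have hgq : ∀ w : Cn n, ‖w‖ < 1 → dist z w ≤ 5 * (1 - ‖w‖) →
        ‖g w‖ * (1 - ‖w‖) ^ (τ + δ) ≤ q := by
      intro w hw hzw
      have hw0 : 0 < 1 - ‖w‖ := by linarith
      have h1 := hC₁ g hg z w hw hzw
      rw [← hI, ← ofReal_norm, ENNReal.ofReal_rpow_of_nonneg (norm_nonneg _) hp.le,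
        ← ENNReal.ofReal_mul (by positivity), ← ENNReal.ofReal_toReal hIt,
        ← ENNReal.ofReal_mul hC₁0.le, ENNReal.ofReal_le_ofReal_iff (by positivity), ← hqp,
        Real.rpow_mul hw0.le, ← Real.mul_rpow (norm_nonneg _) (by positivity)] at h1
      exact (Real.rpow_le_rpow_iff (by positivity) hq0 hp).1 h1
    have h2 := norm_mulOp_le_of_moment hτ hδ0 he hφi hφ hm hg hz hq0 hgq
    have h3 : ‖mulOp m g z‖ ≤ K' * q * (1 - ‖z‖) ^ (-δ) := by
      refine h2.trans ?_
      gcongr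
      simp only [K']; linarith
    have h4 : ‖mulOp m g z‖ ^ p * (1 - ‖z‖) ^ b ≤
        K' ^ p * C₁ * ((1 - ‖z‖) ^ (b - δ * p) * I.toReal) := by
      calc _ ≤ (K' * q * (1 - ‖z‖) ^ (-δ)) ^ p * (1 - ‖z‖) ^ b := by gcongr
        _ = _ := by
          rw [Real.mul_rpow (by positivity) (by positivity), Real.mul_rpow hK'0.le hq0, hqp,
            ← Real.rpow_mul hρ0.le, show b - δ * p = -δ * p + b by ring, Real.rpow_add hρ0]
          ring
    rw [← ENNReal.ofReal_toReal hIt, ← ENNReal.ofReal_mul (by positivity),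
      ← ENNReal.ofReal_mul (by positivity), ← ofReal_norm,
      ENNReal.ofReal_rpow_of_nonneg (norm_nonneg _) hp.le, ← ENNReal.ofReal_mul (by positivity)]
    exact ENNReal.ofReal_le_ofReal h4
  calc bergmanInt p b (mulOp m g)
      ≤ ∫⁻ z in unitBall n, ENNReal.ofReal (K' ^ p * C₁) *
        (ENNReal.ofReal ((1 - ‖z‖) ^ (b - δ * p)) * stolzInt p ((τ + δ) * p - 2 * n) g z) :=
        setLIntegral_mono' measurableSet_ball hpt
    _ ≤ ENNReal.ofReal (K' ^ p * C₁) * (ENNReal.ofReal C₂ * bergmanInt p a g) := by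
        rw [lintegral_const_mul' _ _ ENNReal.ofReal_ne_top]
        gcongr
        have h5 := hC₂ g hg
        rwa [show (τ + δ) * p - 2 * n + (b - δ * p) + 2 * n = a by rw [hb]; ring] at h5
    _ = _ := by rw [← mul_assoc, ← ENNReal.ofReal_mul (by positivity)]

theorem exists_forall_le_of_eventually {e : ℕ → ℂ} {C : ℝ}
    (h : ∀ᶠ j in Filter.atTop, ‖e j‖ ≤ C * (1 / 2) ^ j) :
    ∃ K, ∀ j, ‖e j‖ ≤ K * (1 / 2) ^ j := by
  obtain ⟨j₀, hj₀⟩ := Filter.eventually_atTop.1 h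
  refine ⟨|C| + ∑ j ∈ Finset.range j₀, ‖e j‖ * 2 ^ j, fun j => ?_⟩
  have hs : 0 ≤ ∑ j ∈ Finset.range j₀, ‖e j‖ * 2 ^ j := Finset.sum_nonneg fun _ _ => by positivity
  rcases lt_or_ge j j₀ with hj | hj
  · have h1 : ‖e j‖ * 2 ^ j ≤ ∑ j ∈ Finset.range j₀, ‖e j‖ * 2 ^ j :=
      Finset.single_le_sum (f := fun j => ‖e j‖ * 2 ^ j) (fun _ _ => by positivity)
        (Finset.mem_range.2 hj)
    have h2 : ‖e j‖ = ‖e j‖ * 2 ^ j * (1 / 2) ^ j := by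
      rw [mul_assoc, ← mul_pow]; norm_num
    rw [h2]
    gcongr
    linarith [abs_nonneg C]
  · refine (hj₀ j hj).trans ?_
    gcongr
    linarith [le_abs_self C]

/-- The Beta integral writes the quotient as `1 / Γ(τ)` times the moment of `x ^ (B - 1) * (1 - x) ^
(τ - 1)` over `(0, 1)`. The part over `(0, 1 / 2)` is `O(2 ^ (-j))`. Finitely many `j`, where the
integral may diverge, are absorbed in the error, so the formula is needed only for large `j`. -/
theorem isMult_gamma_ratio (hn : 0 < n) {p a τ : ℝ} (hp : 0 < p) (hτ : 1 ≤ τ)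
    (ha : -1 < a - τ * p) (B κ : ℂ) {m : ℕ → ℂ} (hm : ∀ᶠ j : ℕ in Filter.atTop,
      m j = κ * (Complex.Gamma (j + B) / Complex.Gamma (j + B + τ))) :
    IsMult n p a (a - τ * p) m := by
  have h12 : (1 / 2 : ℝ) ≤ 1 := by norm_num
  set κ' := κ * (Complex.Gamma τ)⁻¹ with hκ'
  let ψ : ℝ → ℂ := fun x => (x : ℂ) ^ (B - 1) * ((1 - x) ^ (τ - 1) : ℝ)
  have hψc : ∀ b c : ℝ, 0 < b → b ≤ c → IntervalIntegrable ψ volume b c := by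
    intro b c hb hbc
    refine ContinuousOn.intervalIntegrable ?_
    rw [Set.uIcc_of_le hbc]
    refine ContinuousOn.mul (fun x hx => ?_) ?_
    · refine (ContinuousAt.comp (f := fun x : ℝ => (x : ℂ))
        (continuousAt_cpow_const ?_) Complex.continuous_ofReal.continuousAt).continuousWithinAt
      exact Complex.ofReal_mem_slitPlane.2 (hb.trans_le hx.1)
    · exact Complex.continuous_ofReal.comp_continuousOn
        (ContinuousOn.rpow_const (by fun_prop) fun x _ => Or.inr (by linarith))
  have hψn : ∀ x : ℝ, 0 < x → x ≤ 1 → ‖ψ x‖ = x ^ (B.re - 1) * (1 - x) ^ (τ - 1) := by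
    intro x hx hx1
    rw [norm_mul, Complex.norm_cpow_eq_rpow_re_of_pos hx, Complex.norm_real,
      Real.norm_of_nonneg (Real.rpow_nonneg (by linarith) _)]
    simp
  obtain ⟨-, C, -, hC0, hC⟩ : ∃ c C : ℝ, 0 < c ∧ 0 < C ∧ ∀ x : ℝ, 1 / 2 ≤ x → x ≤ 2 →
      x ^ (B.re - 1) ≤ C := by
    obtain ⟨c, C, hc, hC, h⟩ := exists_rpow_bounds (B.re - 1)
    exact ⟨c, C, hc, hC, fun x h1 h2 => by simpa using (h 1 x one_pos h1 (by linarith)).2⟩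
  let φ : ℝ → ℂ := fun x => κ' * ψ x
  let e : ℕ → ℂ := fun j => m j - ∫ x in (1 / 2 : ℝ)..1, (x : ℂ) ^ j * φ x
  have hev : ∀ᶠ j : ℕ in Filter.atTop,
      ‖e j‖ ≤ (‖κ'‖ * (1 / 2) ^ (B.re - 1) * |1 / 2 - 0|) * (1 / 2) ^ j := by
    -- For `j ≥ 1 - B.re` the power `x ^ (j + B.re - 1)` is largest at `1 / 2` on `(0, 1 / 2]`.
    obtain ⟨j₀, hj₀⟩ := exists_nat_ge (1 - B.re)
    filter_upwards [hm, Filter.eventually_ge_atTop j₀] with j hmj hj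
    have hjB : 0 ≤ j + B.re - 1 := by
      have : (j₀ : ℝ) ≤ j := by exact_mod_cast hj
      linarith
    have hre : 0 < ((j : ℂ) + B).re := by simp; linarith
    have hτre : 0 < (τ : ℂ).re := by simp; linarith
    have hxj : ∀ x : ℝ, 0 < x → (x : ℂ) ^ j * ψ x =
        (x : ℂ) ^ ((j : ℂ) + B - 1) * ((1 - x) ^ (τ - 1) : ℝ) := by
      intro x hx
      simp only [ψ]
      rw [← mul_assoc, ← Complex.cpow_natCast, ← Complex.cpow_add _ _ (by exact_mod_cast hx.ne')]
      ring_nf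
    have hbeta : Complex.betaIntegral (j + B) τ =
        ∫ x in (0 : ℝ)..1, (x : ℂ) ^ j * ψ x := by
      rw [Complex.betaIntegral]
      refine intervalIntegral.integral_congr_ae (Filter.Eventually.of_forall fun x hx => ?_)
      rw [Set.uIoc_of_le zero_le_one] at hx
      rw [hxj x hx.1, Complex.ofReal_cpow (by linarith [hx.2])]
      push_cast
      rfl
    have hn0 : ∀ x ∈ Set.Ioc (0 : ℝ) (1 / 2), ‖(x : ℂ) ^ j * ψ x‖ ≤ (1 / 2) ^ (j + B.re - 1) := by
      intro x hx
      rw [norm_mul, hψn x hx.1 (by linarith [hx.2]), norm_pow, Complex.norm_real,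
        Real.norm_of_nonneg hx.1.le, ← Real.rpow_natCast, ← mul_assoc, ← Real.rpow_add hx.1,
        ← add_sub_assoc]
      refine (mul_le_of_le_one_right (Real.rpow_nonneg hx.1.le _) (Real.rpow_le_one
        (by linarith [hx.2]) (by linarith [hx.1]) (by linarith))).trans ?_
      exact Real.rpow_le_rpow hx.1.le hx.2 hjB
    have hi1 : IntervalIntegrable (fun x : ℝ => (x : ℂ) ^ j * ψ x) volume (1 / 2) 1 :=
      (hψc _ _ (by norm_num) h12).continuousOn_mul (by fun_prop)
    have hi0 : IntervalIntegrable (fun x : ℝ => (x : ℂ) ^ j * ψ x) volume 0 (1 / 2) := by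
      have hmeas : Measurable ψ := by simp only [ψ]; fun_prop
      rw [intervalIntegrable_iff_integrableOn_Ioc_of_le (by norm_num)]
      refine Measure.integrableOn_of_bounded (M := (1 / 2) ^ (j + B.re - 1)) (by simp) ?_ ?_
      · exact ((by fun_prop : Measurable fun x : ℝ => (x : ℂ) ^ j).mul hmeas).aestronglyMeasurable
      · filter_upwards [ae_restrict_mem measurableSet_Ioc] with x hx
        exact hn0 x hx
    have hej : e j = κ' * ∫ x in (0 : ℝ)..(1 / 2), (x : ℂ) ^ j * ψ x := by
      have hG1 : Complex.Gamma τ ≠ 0 := Complex.Gamma_ne_zero_of_re_pos hτre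
      have hG2 : Complex.Gamma (j + B + τ) ≠ 0 :=
        Complex.Gamma_ne_zero_of_re_pos (by rw [Complex.add_re]; linarith)
      have h1 := Complex.Gamma_mul_Gamma_eq_betaIntegral hre hτre
      rw [hbeta, ← intervalIntegral.integral_add_adjacent_intervals hi0 hi1] at h1
      have h2 : ∫ x in (1 / 2 : ℝ)..1, (x : ℂ) ^ j * φ x =
          κ' * ∫ x in (1 / 2 : ℝ)..1, (x : ℂ) ^ j * ψ x := by
        rw [← intervalIntegral.integral_const_mul]
        simp only [φ]
        congr 1; ext x; ring
      simp only [e]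
      rw [h2, hmj, hκ']
      field_simp
      rw [h1]
      ring
    rw [hej, norm_mul]
    have h3 := intervalIntegral.norm_integral_le_of_norm_le_const (a := 0) (b := 1 / 2)
      (f := fun x : ℝ => (x : ℂ) ^ j * ψ x) (C := (1 / 2) ^ (j + B.re - 1)) (fun x hx => by
        rw [Set.uIoc_of_le (by norm_num)] at hx
        exact hn0 x hx)
    refine (mul_le_mul_of_nonneg_left h3 (norm_nonneg _)).trans_eq ?_
    rw [add_sub_assoc, Real.rpow_add (by norm_num), Real.rpow_natCast]
    ring
  obtain ⟨K, hK⟩ := exists_forall_le_of_eventually hev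
  refine isMult_of_moment hn hp hτ ha (K := max K (‖κ'‖ * C)) (e := e) (φ := φ) (fun j => ?_)
    ((hψc _ _ (by norm_num) h12).const_mul _) (fun x hx => ?_) fun j => by simp [e]
  · exact (hK j).trans (by gcongr; exact le_max_left _ _)
  · have hx0 : 0 < x := by linarith [hx.1]
    have h4 : 0 ≤ (1 - x) ^ (τ - 1) := Real.rpow_nonneg (by linarith [hx.2]) _
    simp only [φ]
    rw [norm_mul, hψn x hx0 hx.2, ← mul_assoc]
    refine mul_le_mul_of_nonneg_right (le_trans ?_ (le_max_right _ _)) h4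
    gcongr
    exact hC x hx.1.le (by linarith [hx.2])

/-! ### Powers of the degree and Gamma quotients of arbitrary real order. -/

theorem bergmanInt_congr {p a : ℝ} {f g : Cn n → ℂ} (h : Set.EqOn f g (unitBall n)) :
    bergmanInt p a f = bergmanInt p a g :=
  setLIntegral_congr_fun measurableSet_ball fun z hz => by simp only [h hz]

theorem isMult_one (p a : ℝ) : IsMult n p a a fun _ => 1 := by
  refine ⟨subExp_const 1, 1, one_pos, fun g hg => ?_⟩
  rw [ENNReal.ofReal_one, one_mul, bergmanInt_congr fun z hz => mulOp_one hg (by simpa using hz)]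

theorem isMult_prod_natCast_add {p a : ℝ} (hn : 0 < n) (hp : 0 < p) (ha : -1 < a) (A : ℕ → ℂ)
    (N : ℕ) : IsMult n p a (a + N * p) fun k => ∏ i ∈ Finset.range N, ((k : ℂ) + A i) := by
  induction N with
  | zero => simpa using isMult_one (n := n) p a
  | succ N ih =>
    have h := (isMult_natCast_add hn hp (a := a + N * p) (by nlinarith [N.cast_nonneg (α := ℝ)])
      (A N)).comp ih
    simp only [Finset.prod_range_succ]
    push_cast
    rw [show a + (N + 1) * p = a + N * p + p by ring]
    simpa only [mul_comm] using h

theorem isMult_natCast_inv_pow {p a : ℝ} (hn : 0 < n) (hp : 0 < p) (N : ℕ)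
    (ha : -1 < a - N * p) : IsMult n p a (a - N * p) fun k => ((k : ℂ)⁻¹) ^ N := by
  induction N with
  | zero => simpa using isMult_one (n := n) p a
  | succ N ih =>
    push_cast at ha ⊢
    -- For `k > 0`, `1 / k = Γ(k) / Γ(k + 1)`; the value `0⁻¹ = 0` at `k = 0` is one of the allowed
    -- exceptions.
    have h1 : IsMult n p (a - N * p) (a - N * p - 1 * p) fun k => (k : ℂ)⁻¹ := by
      refine isMult_gamma_ratio hn hp le_rfl (by linarith) 0 1 ?_
      filter_upwards [Filter.eventually_gt_atTop 0] with j hj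
      have hj' : (j : ℂ) ≠ 0 := by exact_mod_cast hj.ne'
      have hG : Complex.Gamma j ≠ 0 :=
        Complex.Gamma_ne_zero_of_re_pos (by simpa using hj)
      rw [add_zero, Complex.ofReal_one, Complex.Gamma_add_one _ hj']
      field_simp
    have h := h1.comp (ih (by linarith))
    rw [show a - (N + 1) * p = a - N * p - 1 * p by ring]
    simpa only [pow_succ'] using h

theorem NotNegInt.add_natCast_ne_zero {w : ℂ} (h : NotNegInt w) (k : ℕ) : (k : ℂ) + (w + 1) ≠ 0 := by
  intro h0
  refine h (-(k + 1 : ℕ)) (by push_cast; omega) ?_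
  push_cast
  linear_combination h0

theorem gamma_natCast_add_ne_zero {B : ℂ} (h : ∀ k : ℕ, (k : ℂ) + B ≠ 0) (k : ℕ) :
    Complex.Gamma (k + B) ≠ 0 := by
  refine Complex.Gamma_ne_zero fun m hm => h (k + m) ?_
  push_cast
  linear_combination hm

theorem gamma_add_natCast {w : ℂ} {N : ℕ} (h : ∀ i < N, w + i ≠ 0) :
    Complex.Gamma (w + N) = (∏ i ∈ Finset.range N, (w + i)) * Complex.Gamma w := by
  induction N with
  | zero => simp
  | succ N ih =>
    rw [Finset.prod_range_succ, Nat.cast_succ, ← add_assoc,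
      Complex.Gamma_add_one _ (h N N.lt_succ_self), ih fun i hi => h i (hi.trans N.lt_succ_self)]
    ring

theorem subExp_gamma_ratio {A B : ℂ} (hA : ∀ k : ℕ, (k : ℂ) + A ≠ 0)
    (hB : ∀ k : ℕ, (k : ℂ) + B ≠ 0) :
    SubExp fun k => Complex.Gamma (k + B) / Complex.Gamma (k + A) := by
  have hGA := gamma_natCast_add_ne_zero hA
  have hGB := gamma_natCast_add_ne_zero hB
  refine SubExp.of_ratio (Filter.Eventually.of_forall fun k => div_ne_zero (hGB k) (hGA k)) ?_
  have h1 : Filter.Tendsto (fun k : ℕ => 1 + (B - A) * ((k : ℂ) + A)⁻¹) Filter.atTop (nhds 1) := by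
    have h2 : Filter.Tendsto (fun k : ℕ => (k : ℂ) + A) Filter.atTop (Bornology.cobounded ℂ) :=
      (tendsto_add_const_cobounded A).comp (tendsto_natCast_atTop_cobounded (α := ℂ))
    have h3 := (Filter.tendsto_inv₀_cobounded.comp h2).const_mul (B - A)
    simpa using h3.const_add 1
  refine h1.congr fun k => ?_
  have hk : ∀ w : ℂ, ((k + 1 : ℕ) : ℂ) + w = (k + w) + 1 := fun w => by push_cast; ring
  have := hA k
  have := hGA k
  have := hGB k
  rw [hk, hk, Complex.Gamma_add_one _ (hA k), Complex.Gamma_add_one _ (hB k)]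
  field_simp
  ring

/-- The multiplier `κ Γ(k + B) / Γ(k + A)`, whose order of growth is `-t` if `A = B + t`, shifts the
exponent of the weight by `-t p`. -/
theorem isMult_const_mul_gamma_ratio (hn : 0 < n) {p a t : ℝ} (hp : 0 < p) (ha : -1 < a)
    (hat : -1 < a - t * p) {A B : ℂ} (hAB : A = B + t) (hA : ∀ k : ℕ, (k : ℂ) + A ≠ 0) (κ : ℂ) :
    IsMult n p a (a - t * p)
      fun k => κ * (Complex.Gamma (k + B) / Complex.Gamma (k + A)) := by
  -- With `t + N ≥ 1` the Gamma quotient is a moment. The `N` linear factors cancel the surplus in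
  -- `Γ(k + A + N)`, and raising the weight first keeps every intermediate exponent above `-1`.
  obtain ⟨N, hN⟩ := exists_nat_ge (1 - t)
  have h1 := isMult_prod_natCast_add hn hp ha (fun i => A + i) N
  have h2 : IsMult n p (a + N * p) (a + N * p - (t + N) * p)
      fun k => κ * (Complex.Gamma (k + B) / Complex.Gamma (k + B + ((t + N : ℝ) : ℂ))) :=
    isMult_gamma_ratio hn hp (by linarith) (by linarith) B κ (Filter.Eventually.of_forall
      fun _ => rfl)
  have h3 := h2.comp h1
  rw [show a + N * p - (t + N) * p = a - t * p by ring] at h3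
  convert h3 using 2 with k
  have h4 : (k : ℂ) + B + ((t + N : ℝ) : ℂ) = (k + A) + N := by rw [hAB]; push_cast; ring
  have h5 : ∀ i < N, (k : ℂ) + A + i ≠ 0 := fun i _ => by
    have := hA (k + i)
    push_cast at this
    rwa [add_right_comm] at this
  have h6 : ∏ i ∈ Finset.range N, ((k : ℂ) + A + i) ≠ 0 :=
    Finset.prod_ne_zero_iff.2 fun i hi => h5 i (Finset.mem_range.1 hi)
  rw [h4, gamma_add_natCast h5]
  simp only [← add_assoc]
  field_simp

theorem isMult_natCast_pow (hn : 0 < n) {p a : ℝ} (hp : 0 < p) (ha : -1 < a) (N : ℕ) :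
    IsMult n p a (a + N * p) fun k => (k : ℂ) ^ N := by
  simpa using isMult_prod_natCast_add hn hp ha (fun _ => 0) N

/-! ### The Bergman norm as a weighted integral of `R^k f`. -/

/-- The integral defining the Bergman (quasi-)norm. -/
noncomputable def normInt (p α : ℝ) (k : ℕ) (f : Cn n → ℂ) : ℝ≥0∞ :=
  ∫⁻ z, ‖weightedDeriv k f z‖ₑ ^ p ∂vMeasure n α

theorem eLpNorm_weightedDeriv {p : ℝ} (hp : 0 < p) (α : ℝ) (k : ℕ) (f : Cn n → ℂ) :
    eLpNorm (weightedDeriv k f) (ENNReal.ofReal p) (vMeasure n α) =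
      normInt p α k f ^ (1 / p) := by
  rw [eLpNorm_eq_lintegral_rpow_enorm_toReal (by simpa using hp) ENNReal.ofReal_ne_top,
    ENNReal.toReal_ofReal hp.le, normInt]

theorem normInt_eq {p : ℝ} (hp : 0 < p) (α : ℝ) (k : ℕ) (f : Cn n → ℂ) :
    normInt p α k f = ∫⁻ z in unitBall n,
      ‖radialDeriv^[k] f z‖ₑ ^ p * ENNReal.ofReal ((1 - ‖z‖ ^ 2) ^ (p * k + α)) := by
  rw [normInt, vMeasure, lintegral_withDensity_eq_lintegral_mul_non_measurable _ (by fun_prop)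
    (Filter.Eventually.of_forall fun _ => ENNReal.ofReal_lt_top)]
  refine setLIntegral_congr_fun measurableSet_ball fun z hz => ?_
  rw [mem_ball_zero_iff] at hz
  have h0 : 0 < 1 - ‖z‖ ^ 2 := by nlinarith [norm_nonneg z]
  simp only [Pi.mul_apply, weightedDeriv, enorm_mul]
  rw [ENNReal.mul_rpow_of_nonneg _ _ hp.le, ← ofReal_norm, Complex.norm_real,
    Real.norm_of_nonneg (by positivity), ENNReal.ofReal_rpow_of_nonneg (by positivity) hp.le,
    ← mul_assoc, ← ENNReal.ofReal_mul (by positivity), mul_comm]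
  congr 2
  rw [← Real.rpow_natCast (1 - ‖z‖ ^ 2) k, ← Real.rpow_mul h0.le, ← Real.rpow_add h0]
  ring_nf

/-- On the ball `1 - ‖z‖ ≤ 1 - ‖z‖ ^ 2 ≤ 2 * (1 - ‖z‖)`, so the two weights are interchangeable. -/
theorem exists_normInt_bounds {p : ℝ} (hp : 0 < p) (α : ℝ) (k : ℕ) :
    ∃ C : ℝ, 0 < C ∧ ∀ f : Cn n → ℂ,
      normInt p α k f ≤ ENNReal.ofReal C * bergmanInt p (p * k + α) (radialDeriv^[k] f) ∧
      bergmanInt p (p * k + α) (radialDeriv^[k] f) ≤ ENNReal.ofReal C * normInt p α k f := by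
  obtain ⟨c, C, hc0, hC0, h⟩ := exists_rpow_bounds (p * k + α)
  have h' : ∀ z ∈ unitBall n, c * (1 - ‖z‖) ^ (p * k + α) ≤ (1 - ‖z‖ ^ 2) ^ (p * k + α) ∧
      (1 - ‖z‖ ^ 2) ^ (p * k + α) ≤ C * (1 - ‖z‖) ^ (p * k + α) := by
    intro z hz
    rw [mem_ball_zero_iff] at hz
    exact h _ _ (by linarith) (by nlinarith [norm_nonneg z]) (by nlinarith [norm_nonneg z])
  have hmax : 0 < max C c⁻¹ := lt_max_of_lt_left hC0
  refine ⟨max C c⁻¹, hmax, fun f => ?_⟩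
  rw [normInt_eq hp, bergmanInt, ← lintegral_const_mul' _ _ ENNReal.ofReal_ne_top,
    ← lintegral_const_mul' _ _ ENNReal.ofReal_ne_top]
  constructor
  · refine setLIntegral_mono' measurableSet_ball fun z hz => ?_
    rw [mul_left_comm, ← ENNReal.ofReal_mul hmax.le]
    rw [mem_ball_zero_iff] at hz
    have : 0 < 1 - ‖z‖ := by linarith
    gcongr
    refine (h' z (by simpa using hz)).2.trans ?_
    gcongr
    exact le_max_left _ _
  · refine setLIntegral_mono' measurableSet_ball fun z hz => ?_
    rw [mul_left_comm, ← ENNReal.ofReal_mul hmax.le]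
    rw [mem_ball_zero_iff] at hz
    have h2 : 0 < 1 - ‖z‖ ^ 2 := by nlinarith [norm_nonneg z]
    gcongr
    have h1 := (h' z (by simpa using hz)).1
    rw [← le_inv_mul_iff₀ hc0] at h1
    refine h1.trans ?_
    gcongr
    exact le_max_right _ _

theorem memBergman_iff {p α : ℝ} (hp : 0 < p) {k : ℕ} {f : Cn n → ℂ} (hf : Holo f) :
    MemBergman p α k f ↔ normInt p α k f < ⊤ := by
  have hmeas : AEStronglyMeasurable (weightedDeriv k f) (vMeasure n α) := by
    refine AEStronglyMeasurable.mono_ac (withDensity_absolutelyContinuous _ _) ?_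
    refine ContinuousOn.aestronglyMeasurable ?_ measurableSet_ball
    exact ContinuousOn.mul (by fun_prop) (iterate_radialDeriv hf k).1.continuousOn
  rw [MemBergman, and_iff_right hf, MemLp, and_iff_right hmeas, eLpNorm_weightedDeriv hp]
  exact ENNReal.rpow_lt_top_iff_of_pos (by positivity)

theorem ennreal_add_rpow_le {x y : ℝ≥0∞} {r : ℝ} (hr : 0 ≤ r) :
    (x + y) ^ r ≤ 2 ^ r * (x ^ r + y ^ r) := by
  have h1 : x + y ≤ 2 * max x y := by
    rw [two_mul]; exact add_le_add (le_max_left _ _) (le_max_right _ _)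
  refine (ENNReal.rpow_le_rpow h1 hr).trans ?_
  rw [ENNReal.mul_rpow_of_nonneg _ _ hr]
  gcongr
  rcases le_total x y with h | h
  · rw [max_eq_right h]; exact le_add_self
  · rw [max_eq_left h]; exact le_self_add

/-! ### The fractional operator as a multiplier. -/

section FractionalOperator

variable {p α : ℝ} {k : ℕ} {s : ℂ}

theorem fracCoeff_eq (n : ℕ) (s t : ℂ) (j : ℕ) : fracCoeff n s t j =
    Complex.Gamma (n + s + t + 1) / Complex.Gamma (n + s + 1) *
      (Complex.Gamma (j + (n + s + 1)) / Complex.Gamma (j + (n + s + t + 1))) := by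
  rw [fracCoeff, div_mul_div_comm]
  ring_nf

theorem fracCoeff_ne_zero {t : ℂ} (hs : NotNegInt (n + s)) (hst : NotNegInt (n + s + t)) (j : ℕ) :
    fracCoeff n s t j ≠ 0 := by
  have hA := gamma_natCast_add_ne_zero hst.add_natCast_ne_zero
  have hB := gamma_natCast_add_ne_zero hs.add_natCast_ne_zero
  have hA0 := hA 0
  have hB0 := hB 0
  rw [Nat.cast_zero, zero_add] at hA0 hB0
  rw [fracCoeff_eq]
  exact mul_ne_zero (div_ne_zero hA0 hB0) (div_ne_zero (hB j) (hA j))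

theorem fracCoeff_zero {t : ℂ} (hs : NotNegInt (n + s)) (hst : NotNegInt (n + s + t)) :
    fracCoeff n s t 0 = 1 := by
  have hA0 := gamma_natCast_add_ne_zero hst.add_natCast_ne_zero 0
  have hB0 := gamma_natCast_add_ne_zero hs.add_natCast_ne_zero 0
  rw [fracCoeff_eq]
  rw [Nat.cast_zero, zero_add] at hA0 hB0 ⊢
  rw [zero_add]
  field_simp

theorem subExp_fracCoeff {t : ℂ} (hs : NotNegInt (n + s)) (hst : NotNegInt (n + s + t)) :
    SubExp (fracCoeff n s t) := by
  have := (subExp_const (Complex.Gamma (n + s + t + 1) / Complex.Gamma (n + s + 1))).mul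
    (subExp_gamma_ratio hst.add_natCast_ne_zero hs.add_natCast_ne_zero)
  simpa only [← fracCoeff_eq] using this

theorem inv_fracCoeff_eq (n : ℕ) (s t : ℂ) (j : ℕ) : (fracCoeff n s t j)⁻¹ =
    Complex.Gamma (n + s + 1) / Complex.Gamma (n + s + t + 1) *
      (Complex.Gamma (j + (n + s + t + 1)) / Complex.Gamma (j + (n + s + 1))) := by
  rw [fracCoeff_eq, mul_inv, inv_div, inv_div]

theorem subExp_inv_fracCoeff {t : ℂ} (hs : NotNegInt (n + s)) (hst : NotNegInt (n + s + t)) :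
    SubExp fun j => (fracCoeff n s t j)⁻¹ := by
  have := (subExp_const (Complex.Gamma (n + s + 1) / Complex.Gamma (n + s + t + 1))).mul
    (subExp_gamma_ratio hs.add_natCast_ne_zero hst.add_natCast_ne_zero)
  simpa only [← inv_fracCoeff_eq] using this

theorem fracInt_zero {t : ℂ} (hs : NotNegInt (n + s)) (hst : NotNegInt (n + s + t))
    {f : Cn n → ℂ} (hf : Holo f) : fracInt s t f 0 = f 0 := by
  rw [fracInt_eq_mulOp, ← homComponent_zero_eq (mulOp _ f) 0,
    homComponent_mulOp hf (subExp_fracCoeff hs hst), fracCoeff_zero hs hst, one_mul,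
    homComponent_zero_eq]

/-- `R^k f` is the image of `fracInt f` under the symbol `j ^ k / c j`. Applying `j ^ k` first
raises the exponent from `0` to `k * p`, and `1 / c j` then moves it by `α`. -/
theorem exists_normInt_le_fracInt (hn : 0 < n) (hp : 0 < p) (hk : -1 < p * k + α)
    (hs : NotNegInt (n + s)) (hst : NotNegInt (n + s + ((α / p : ℝ) : ℂ))) :
    ∃ C : ℝ, 0 < C ∧ ∀ f : Cn n → ℂ, Holo f →
      normInt p α k f ≤ ENNReal.ofReal C * normInt p 0 0 (fracInt s ((α / p : ℝ) : ℂ) f) := by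
  set c := fracCoeff n s ((α / p : ℝ) : ℂ) with hc
  have hcs : SubExp c := subExp_fracCoeff hs hst
  have hαp : α / p * p = α := div_mul_cancel₀ _ hp.ne'
  have hu : IsMult n p 0 (p * k + α) fun j => (c j)⁻¹ * (j : ℂ) ^ k := by
    have h1 := isMult_natCast_pow hn hp (a := 0) (by norm_num) k
    have h2 := isMult_const_mul_gamma_ratio hn hp (a := 0 + k * p) (t := -(α / p))
      (A := n + s + 1) (B := n + s + ((α / p : ℝ) : ℂ) + 1) (by linarith [mul_nonneg k.cast_nonneg hp.le])
      (by rw [neg_mul, hαp]; linarith) (by push_cast; ring) hs.add_natCast_ne_zero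
      (Complex.Gamma (n + s + 1) / Complex.Gamma (n + s + ((α / p : ℝ) : ℂ) + 1))
    have h3 := h2.comp h1
    rw [show 0 + k * p - -(α / p) * p = p * k + α by rw [neg_mul, hαp]; ring] at h3
    simpa only [← inv_fracCoeff_eq] using h3
  obtain ⟨-, C₁, hC₁0, hC₁⟩ := hu
  obtain ⟨C₂, hC₂0, hC₂⟩ := exists_normInt_bounds (n := n) hp α k
  obtain ⟨C₃, hC₃0, hC₃⟩ := exists_normInt_bounds (n := n) hp 0 0
  refine ⟨C₂ * (C₁ * C₃), by positivity, fun f hf => ?_⟩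
  have h4 := hC₁ (mulOp c f) (holo_mulOp hf hcs)
  have h5 : (fun j => (c j)⁻¹ * (j : ℂ) ^ k * c j) = fun j : ℕ => (j : ℂ) ^ k := by
    ext j
    rw [mul_right_comm, inv_mul_cancel₀ (fracCoeff_ne_zero hs hst j), one_mul]
  rw [mulOp_mulOp hf hcs, h5, ← bergmanInt_congr (iterate_radialDeriv hf k).2] at h4
  have h6 := (hC₃ (mulOp c f)).2
  simp only [Nat.cast_zero, mul_zero, add_zero, Function.iterate_zero, id_eq] at h6
  rw [ENNReal.ofReal_mul hC₂0.le, ENNReal.ofReal_mul hC₁0.le, mul_assoc, mul_assoc]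
  refine (hC₂ f).1.trans ?_
  gcongr
  refine h4.trans ?_
  gcongr
  exact h6

/-- Conversely `c j / j ^ k` applied to `R^k f` recovers `fracInt f` except possibly for its
constant term, which `R^k` kills when `k > 0`. Hence the summand with `f 0`. -/
theorem exists_fracInt_normInt_le (hn : 0 < n) (hp : 0 < p) (hk : -1 < p * k + α)
    (hs : NotNegInt (n + s)) (hst : NotNegInt (n + s + ((α / p : ℝ) : ℂ))) :
    ∃ C : ℝ, 0 < C ∧ ∀ f : Cn n → ℂ, Holo f →
      normInt p 0 0 (fracInt s ((α / p : ℝ) : ℂ) f) ≤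
        ENNReal.ofReal C * (‖f 0‖ₑ ^ p + normInt p α k f) := by
  set c := fracCoeff n s ((α / p : ℝ) : ℂ) with hc
  have hcs : SubExp c := subExp_fracCoeff hs hst
  have hαp : α / p * p = α := div_mul_cancel₀ _ hp.ne'
  have hd : IsMult n p (p * k + α) 0 fun j => ((j : ℂ)⁻¹) ^ k * c j := by
    have h1 := isMult_const_mul_gamma_ratio hn hp (a := p * k + α) (t := α / p)
      (B := n + s + 1) (A := n + s + ((α / p : ℝ) : ℂ) + 1) hk
      (by rw [hαp]; linarith [mul_nonneg hp.le (k.cast_nonneg (α := ℝ))]) (by ring) hst.add_natCast_ne_zero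
      (Complex.Gamma (n + s + ((α / p : ℝ) : ℂ) + 1) / Complex.Gamma (n + s + 1))
    have h2 := isMult_natCast_inv_pow hn hp (a := p * k + α - α / p * p) k (by
      rw [hαp]; linarith)
    have h3 := h2.comp h1
    rw [show p * k + α - α / p * p - k * p = 0 by rw [hαp]; ring] at h3
    simpa only [← fracCoeff_eq] using h3
  obtain ⟨hds, C₁, hC₁0, hC₁⟩ := hd
  obtain ⟨C₂, hC₂0, hC₂⟩ := exists_normInt_bounds (n := n) hp α k
  obtain ⟨C₃, hC₃0, hC₃⟩ := exists_normInt_bounds (n := n) hp 0 0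
  set v := (volume : Measure (Cn n)).real (ball 0 1)
  have hv : volume (unitBall n) = ENNReal.ofReal v := by
    simp only [v, measureReal_def]
    rw [ENNReal.ofReal_toReal measure_ball_lt_top.ne]
  refine ⟨C₃ * 2 ^ p * (v + C₁ * C₂), by positivity, fun f hf => ?_⟩
  have h4 := hC₁ (radialDeriv^[k] f) (iterate_radialDeriv hf k).1
  have h5 : ∀ z ∈ unitBall n, ‖mulOp c f z‖ₑ ≤ ‖mulOp (fun j => ((j : ℂ)⁻¹) ^ k * c j)
      (radialDeriv^[k] f) z‖ₑ + ‖f 0‖ₑ := by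
    intro z hz
    have hz' : ‖z‖ < 1 := by simpa using hz
    have hjk : SubExp fun j => (j : ℂ) ^ k := subExp_natCast.pow k
    rw [mulOp_congr (iterate_radialDeriv hf k).2, mulOp_mulOp hf hjk]
    obtain ⟨ε, hε, h6⟩ : ∃ ε : ℂ, ‖ε‖ ≤ 1 ∧ mulOp c f z =
        mulOp (fun j => ((j : ℂ)⁻¹) ^ k * c j * (j : ℂ) ^ k) f z + ε * f 0 := by
      -- As `c 0 = 1`, this number is `0` for `k = 0` (by `0 ^ 0 = 1`) and `1` for `k > 0`.
      refine ⟨c 0 - ((0 : ℕ) : ℂ)⁻¹ ^ k * c 0 * ((0 : ℕ) : ℂ) ^ k, ?_, ?_⟩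
      · rw [hc, fracCoeff_zero hs hst]
        rcases k with _ | k <;> simp
      · have h7 := (summable_mulOp hf hcs hz').hasSum.sub
          (summable_mulOp hf (hds.mul hjk) hz').hasSum
        have h8 := h7.unique (hasSum_single 0 fun j hj => ?_)
        · rw [homComponent_zero_eq, ← sub_mul] at h8
          rw [← h8]
          simp only [mulOp]
          ring
        · have hj' : (j : ℂ) ≠ 0 := by exact_mod_cast hj
          have : (j : ℂ)⁻¹ ^ k * c j * (j : ℂ) ^ k = c j := by
            rw [mul_right_comm, ← mul_pow, inv_mul_cancel₀ hj', one_pow, one_mul]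
          rw [this, sub_self]
    rw [h6]
    refine (enorm_add_le _ _).trans ?_
    gcongr
    rw [enorm_mul]
    refine mul_le_of_le_one_left zero_le ?_
    rw [← ofReal_norm]
    exact ENNReal.ofReal_le_one.2 hε
  have h9 : bergmanInt p 0 (mulOp c f) ≤ ENNReal.ofReal (2 ^ p) *
      (bergmanInt p 0 (mulOp (fun j => ((j : ℂ)⁻¹) ^ k * c j) (radialDeriv^[k] f)) +
        ENNReal.ofReal v * ‖f 0‖ₑ ^ p) := by
    have h10 : ENNReal.ofReal v * ‖f 0‖ₑ ^ p = ∫⁻ _ in unitBall n, ‖f 0‖ₑ ^ p := by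
      rw [setLIntegral_const, hv, mul_comm]
    rw [h10, bergmanInt, bergmanInt, ← lintegral_add_right _ measurable_const,
      ← lintegral_const_mul' _ _ ENNReal.ofReal_ne_top]
    refine setLIntegral_mono' measurableSet_ball fun z hz => ?_
    rw [Real.rpow_zero, ENNReal.ofReal_one, mul_one, mul_one,
      ← ENNReal.ofReal_rpow_of_nonneg zero_le_two hp.le, ENNReal.ofReal_ofNat]
    exact (ENNReal.rpow_le_rpow (h5 z hz) hp.le).trans (ennreal_add_rpow_le hp.le)
  have h11 := (hC₃ (mulOp c f)).1
  simp only [Nat.cast_zero, mul_zero, add_zero, Function.iterate_zero, id_eq] at h11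
  have hv0 : 0 ≤ v := measureReal_nonneg
  refine h11.trans ?_
  calc ENNReal.ofReal C₃ * bergmanInt p 0 (mulOp c f)
      ≤ ENNReal.ofReal C₃ * (ENNReal.ofReal (2 ^ p) * (ENNReal.ofReal C₁ *
        (ENNReal.ofReal C₂ * normInt p α k f) + ENNReal.ofReal v * ‖f 0‖ₑ ^ p)) := by
        gcongr
        refine h9.trans ?_
        gcongr
        refine h4.trans ?_
        gcongr
        exact (hC₂ f).2
    _ ≤ ENNReal.ofReal C₃ * (ENNReal.ofReal (2 ^ p) * ((ENNReal.ofReal v +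
        ENNReal.ofReal C₁ * ENNReal.ofReal C₂) * (‖f 0‖ₑ ^ p + normInt p α k f))) := by
        gcongr
        rw [add_mul, mul_add, mul_add, ← mul_assoc]
        rw [add_comm]
        gcongr
        · exact le_self_add
        · exact le_add_self
    _ = _ := by
        rw [ENNReal.ofReal_mul (by positivity), ENNReal.ofReal_mul hC₃0.le,
          ENNReal.ofReal_add hv0 (by positivity), ENNReal.ofReal_mul hC₁0.le]
        ring

theorem homComponent_linear {f g : Cn n → ℂ} (hf : Holo f) (hg : Holo g) (a b : ℂ) {z : Cn n}
    (hz : ‖z‖ < 1) (j : ℕ) : homComponent (fun z => a * f z + b * g z) j z =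
      a * homComponent f j z + b * homComponent g j z := by
  have h : Holo fun z => a * f z + b * g z :=
    (DifferentiableOn.const_mul hf a).add (DifferentiableOn.const_mul hg b)
  refine homComponent_unique (q := fun j => a * homComponent f j z + b * homComponent g j z) h
    one_pos (fun c hc => ?_) j
  have h1 := ((hasSum_homComponent_smul hf (by linarith : 1 * ‖z‖ ≤ 1) hc).mul_left a).add
    ((hasSum_homComponent_smul hg (by linarith : 1 * ‖z‖ ≤ 1) hc).mul_left b)
  refine h1.congr_fun fun j => ?_
  ring

theorem mulOp_linear {m : ℕ → ℂ} (hm : SubExp m) {f g : Cn n → ℂ} (hf : Holo f) (hg : Holo g)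
    (a b : ℂ) {z : Cn n} (hz : ‖z‖ < 1) : mulOp m (fun z => a * f z + b * g z) z =
      a * mulOp m f z + b * mulOp m g z := by
  have h1 := ((summable_mulOp hf hm hz).hasSum.mul_left a).add
    ((summable_mulOp hg hm hz).hasSum.mul_left b)
  refine HasSum.tsum_eq (h1.congr_fun fun j => ?_)
  rw [homComponent_linear hf hg a b hz]
  ring

theorem mulOp_inv_mulOp {m : ℕ → ℂ} (hm : SubExp m) (h0 : ∀ j, m j ≠ 0) {f : Cn n → ℂ}
    (hf : Holo f) : Set.EqOn (mulOp (fun j => (m j)⁻¹) (mulOp m f)) f (unitBall n) := by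
  intro z hz
  have : (fun j => (m j)⁻¹ * m j) = fun _ => 1 := by
    ext j; exact inv_mul_cancel₀ (h0 j)
  rw [mulOp_mulOp hf hm, this, mulOp_one hf (by simpa using hz)]

theorem mulOp_mulOp_inv {m : ℕ → ℂ} (hm : SubExp fun j => (m j)⁻¹) (h0 : ∀ j, m j ≠ 0)
    {f : Cn n → ℂ} (hf : Holo f) :
    Set.EqOn (mulOp m (mulOp (fun j => (m j)⁻¹) f)) f (unitBall n) := by
  simpa using mulOp_inv_mulOp hm (fun j => inv_ne_zero (h0 j)) hf

theorem memBergman_fracInt_iff (hn : 0 < n) (hp : 0 < p) (hk : -1 < p * k + α)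
    (hs : NotNegInt (n + s)) (hst : NotNegInt (n + s + ((α / p : ℝ) : ℂ))) {f : Cn n → ℂ}
    (hf : Holo f) : MemBergman p α k f ↔ MemBergman p 0 0 (fracInt s ((α / p : ℝ) : ℂ) f) := by
  rw [memBergman_iff hp hf, 
    memBergman_iff (f := fracInt s ((α / p : ℝ) : ℂ) f) hp
      (holo_mulOp hf (subExp_fracCoeff hs hst))]
  obtain ⟨C, -, hC⟩ := exists_normInt_le_fracInt hn hp hk hs hst
  obtain ⟨C', -, hC'⟩ := exists_fracInt_normInt_le hn hp hk hs hst
  constructor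
  · intro h
    refine (hC' f hf).trans_lt (ENNReal.mul_lt_top ENNReal.ofReal_lt_top
      (ENNReal.add_lt_top.2 ⟨?_, h⟩))
    exact ENNReal.rpow_lt_top_of_nonneg hp.le enorm_ne_top
  · intro h
    exact (hC f hf).trans_lt (ENNReal.mul_lt_top ENNReal.ofReal_lt_top h)

theorem normInt_zero_congr {f g : Cn n → ℂ} (hp : 0 < p) (h : Set.EqOn f g (unitBall n)) :
    normInt p 0 0 f = normInt p 0 0 g := by
  rw [normInt_eq hp, normInt_eq hp]
  refine setLIntegral_congr_fun measurableSet_ball fun z hz => ?_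
  simp only [Function.iterate_zero, id_eq, h hz]

/-- Taking `1 / p`-th powers of the two integral inequalities suffices, since `fracInt` preserves
the value at the origin. The factor `2 ^ (1 / p)` covers the failure of subadditivity of `x ^ (1 /
p)` for `p < 1`. -/
theorem exists_bergmanNorm_bounds (hn : 0 < n) (hp : 0 < p) (hk : -1 < p * k + α)
    (hs : NotNegInt (n + s)) (hst : NotNegInt (n + s + ((α / p : ℝ) : ℂ))) :
    ∃ C : ℝ≥0, ∀ f : Cn n → ℂ, Holo f →
      bergmanNorm p 0 0 (fracInt s ((α / p : ℝ) : ℂ) f) ≤ C * bergmanNorm p α k f ∧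
      bergmanNorm p α k f ≤ C * bergmanNorm p 0 0 (fracInt s ((α / p : ℝ) : ℂ) f) := by
  obtain ⟨C₁, -, hC₁⟩ := exists_normInt_le_fracInt hn hp hk hs hst
  obtain ⟨C₂, -, hC₂⟩ := exists_fracInt_normInt_le hn hp hk hs hst
  have hp' : 0 ≤ 1 / p := by positivity
  set D₁ : ℝ≥0 := C₁.toNNReal ^ (1 / p)
  set D₂ : ℝ≥0 := C₂.toNNReal ^ (1 / p) * 2 ^ (1 / p)
  refine ⟨1 + D₁ + D₂, fun f hf => ?_⟩
  simp only [bergmanNorm, eLpNorm_weightedDeriv hp, fracInt_zero hs hst hf]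
  have h1 := ENNReal.rpow_le_rpow (hC₁ f hf) hp'
  have h2 := ENNReal.rpow_le_rpow (hC₂ f hf) hp'
  rw [ENNReal.mul_rpow_of_nonneg _ _ hp'] at h1 h2
  have e1 : ENNReal.ofReal C₁ ^ (1 / p) = (D₁ : ℝ≥0∞) := by
    rw [ENNReal.ofReal, ← ENNReal.coe_rpow_of_nonneg _ hp']
  have e2 : ENNReal.ofReal C₂ ^ (1 / p) * 2 ^ (1 / p) = (D₂ : ℝ≥0∞) := by
    rw [ENNReal.ofReal, ← ENNReal.coe_rpow_of_nonneg _ hp', ENNReal.coe_mul,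
      ENNReal.coe_rpow_of_nonneg 2 hp']
    rfl
  have h3 := h2.trans (mul_le_mul_right (ennreal_add_rpow_le hp') _)
  rw [← mul_assoc, e2, ← ENNReal.rpow_mul, mul_one_div_cancel hp.ne', ENNReal.rpow_one] at h3
  rw [e1] at h1
  set X := normInt p α k f ^ (1 / p)
  set Y := normInt p 0 0 (fracInt s ((α / p : ℝ) : ℂ) f) ^ (1 / p)
  push_cast
  constructor
  · calc ‖f 0‖ₑ + Y ≤ 1 * (‖f 0‖ₑ + X) + D₂ * (‖f 0‖ₑ + X) := by
          rw [one_mul]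
          exact add_le_add le_self_add h3
      _ = (1 + D₂) * (‖f 0‖ₑ + X) := by rw [add_mul]
      _ ≤ (1 + D₁ + D₂) * (‖f 0‖ₑ + X) := by
          refine mul_le_mul_left (add_le_add_left le_self_add _) _
  · calc ‖f 0‖ₑ + X ≤ 1 * (‖f 0‖ₑ + Y) + D₁ * (‖f 0‖ₑ + Y) := by
          rw [one_mul]
          refine add_le_add le_self_add (h1.trans ?_)
          gcongr
          exact le_add_self
      _ = (1 + D₁) * (‖f 0‖ₑ + Y) := by rw [add_mul]
      _ ≤ _ := mul_le_mul_left le_self_add _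

end FractionalOperator

end BergmanBall

theorem mainTheorem1 (n : ℕ) (hn : 0 < n) (p α : ℝ) (hp : 0 < p)
    (k : ℕ) (hk : -1 < p * k + α) (s : ℂ)
    (hs : BergmanBall.NotNegInt (n + s))
    (hst : BergmanBall.NotNegInt (n + s + ((α / p : ℝ) : ℂ))) :
    -- on holomorphic functions the operator is well defined, and it detects membership
    (∀ f : BergmanBall.Cn n → ℂ, BergmanBall.Holo f →
      (∀ z ∈ BergmanBall.unitBall n,
        Summable (BergmanBall.fracIntTerm s ((α / p : ℝ) : ℂ) f z)) ∧
      BergmanBall.Holo (BergmanBall.fracInt s ((α / p : ℝ) : ℂ) f) ∧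
      (BergmanBall.MemBergman p α k f ↔
        BergmanBall.MemBergman p 0 0 (BergmanBall.fracInt s ((α / p : ℝ) : ℂ) f))) ∧
    -- it is linear
    (∀ f g : BergmanBall.Cn n → ℂ, BergmanBall.Holo f → BergmanBall.Holo g → ∀ a b : ℂ,
      Set.EqOn (BergmanBall.fracInt s ((α / p : ℝ) : ℂ) (fun z => a * f z + b * g z))
        (fun z => a * BergmanBall.fracInt s ((α / p : ℝ) : ℂ) f z +
          b * BergmanBall.fracInt s ((α / p : ℝ) : ℂ) g z)
        (BergmanBall.unitBall n)) ∧
    -- it is injective on the weighted space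
    (∀ f g : BergmanBall.Cn n → ℂ,
      BergmanBall.MemBergman p α k f → BergmanBall.MemBergman p α k g →
      Set.EqOn (BergmanBall.fracInt s ((α / p : ℝ) : ℂ) f)
        (BergmanBall.fracInt s ((α / p : ℝ) : ℂ) g) (BergmanBall.unitBall n) →
      Set.EqOn f g (BergmanBall.unitBall n)) ∧
    -- it maps the weighted space onto the unweighted space
    (∀ g : BergmanBall.Cn n → ℂ, BergmanBall.MemBergman p 0 0 g →
      ∃ f : BergmanBall.Cn n → ℂ, BergmanBall.MemBergman p α k f ∧
        Set.EqOn (BergmanBall.fracInt s ((α / p : ℝ) : ℂ) f) g (BergmanBall.unitBall n)) ∧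
    -- it and its inverse are bounded
    (∃ C : ℝ≥0, ∀ f : BergmanBall.Cn n → ℂ, BergmanBall.MemBergman p α k f →
      BergmanBall.bergmanNorm p 0 0 (BergmanBall.fracInt s ((α / p : ℝ) : ℂ) f) ≤
        C * BergmanBall.bergmanNorm p α k f ∧
      BergmanBall.bergmanNorm p α k f ≤
        C * BergmanBall.bergmanNorm p 0 0 (BergmanBall.fracInt s ((α / p : ℝ) : ℂ) f)) := by
  have hcs := BergmanBall.subExp_fracCoeff hs hst
  have hcs' := BergmanBall.subExp_inv_fracCoeff hs hst
  have hc0 := BergmanBall.fracCoeff_ne_zero hs hst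
  refine ⟨fun f hf => ⟨fun z hz => ?_, BergmanBall.holo_mulOp hf hcs,
    BergmanBall.memBergman_fracInt_iff hn hp hk hs hst hf⟩, fun f g hf hg a b z hz => ?_,
    fun f g hf hg hfg z hz => ?_, fun g hg => ?_, ?_⟩
  · exact BergmanBall.summable_mulOp hf hcs (by simpa using hz)
  · exact BergmanBall.mulOp_linear hcs hf hg a b (by simpa using hz)
  · have h := BergmanBall.mulOp_congr hfg
      fun j => (BergmanBall.fracCoeff n s ((α / p : ℝ) : ℂ) j)⁻¹
    rw [← BergmanBall.mulOp_inv_mulOp hcs hc0 hf.1 hz,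
      ← BergmanBall.mulOp_inv_mulOp hcs hc0 hg.1 hz]
    exact congrFun h z
  -- The preimage is the multiplier with reciprocal coefficients applied to `g`; the equivalence of
  -- memberships places it in the weighted space.
  · have hf := BergmanBall.holo_mulOp hg.1 hcs'
    have heq := BergmanBall.mulOp_mulOp_inv hcs' hc0 hg.1
    refine ⟨_, (BergmanBall.memBergman_fracInt_iff hn hp hk hs hst hf).2 ?_, heq⟩
    rw [BergmanBall.fracInt_eq_mulOp, BergmanBall.memBergman_iff hp (BergmanBall.holo_mulOp hf hcs),
      BergmanBall.normInt_zero_congr hp heq]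
    exact (BergmanBall.memBergman_iff hp hg.1).1 hg
  · obtain ⟨C, hC⟩ := BergmanBall.exists_bergmanNorm_bounds hn hp hk hs hst
    exact ⟨C, fun f hf => hC f hf.1⟩
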